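/- Let $X \subseteq \mathbb{R}^d$ be an open set with locally Lipschitz boundary (possibly unbounded, possibly $X=\mathbb{R}^d$), with surface measure $S$ (the normalized $(d-1)$-dimensional Hausdorff measure on $\partial X$) and outward unit normal $n$, defined $S$-almost everywhere on $\partial X$. Let $q \ge 0$ be a differentiable probability density on $X$, and let $f : X \to \mathbb{R}^d$ be a differentiable vector field with $f \in L^2(q)$, such that $fq$ extends continuously to $\overline{X}$ and such that the expectations $E_{x\sim q}[\operatorname{div} f(x)]$ and $E_{x\sim q}[f(x)^T\nabla\log q(x)]$ exist (that is, both integrands are $q$-integrable), where $\operatorname{div} f = \sum_{i=1}^d \partial f_i/\partial x_i$. Assume that the boundary flux of $fq$ vanishes, in the following sense: - if $X \ne \mathbb{R}^d$, the integral $\int_{\partial X} f(x)^T n(x)\, q(x)\, dS(x)$ converges absolutely and equals $0$; - if $X = \mathbb{R}^d$, then $\int_{\partial B_r} f(x)^T n(x)\, q(x)\, dS(x) \to 0$ as $r \to \infty$, where $B_r$ is the ball of radius $r$ centered at the origin, and $n$ and $S$ are its outward unit normal and surface measure. Then $$E_{x\sim q}[\operatorname{div} f(x)] = -E_{x\sim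 q}[f(x)^T \nabla \log q(x)].$$ -/

import Mathlib

open MeasureTheory Filter Topology Set
open scoped Gradient RealInnerProductSpace ENNReal NNReal

/-- The divergence `∑ i, ∂ f_i / ∂ x_i` of a vector field on `ℝ^d`. -/
noncomputable def divergence {d : ℕ}
    (f : EuclideanSpace ℝ (Fin d) → EuclideanSpace ℝ (Fin d)) (x : EuclideanSpace ℝ (Fin d)) : ℝ :=
  ∑ i : Fin d, (fderiv ℝ f x (EuclideanSpace.single i 1)) i

/-- The measure on `X` with Lebesgue density `q`. -/
noncomputable def densityMeasure {d : ℕ} (X : Set (EuclideanSpace ℝ (Fin d)))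
    (q : EuclideanSpace ℝ (Fin d) → ℝ) : Measure (EuclideanSpace ℝ (Fin d)) :=
  (volume.restrict X).withDensity (fun x => ENNReal.ofReal (q x))

/-- `X` has a locally Lipschitz boundary: near each boundary point `p`, and for a suitable unit
vector `ν`, the set `X` is the region strictly above (in the direction `ν`) the graph of a Lipschitz
function on the hyperplane orthogonal to `ν`. The vector `x - ⟪ν, x⟫ • ν` is the orthogonal
projection of `x` to that hyperplane. -/
def HasLipschitzBoundary {d : ℕ} (X : Set (EuclideanSpace ℝ (Fin d))) : Prop :=
  ∀ p ∈ frontier X, ∃ U ∈ 𝓝 p, ∃ ν : EuclideanSpace ℝ (Fin d), ‖ν‖ = 1 ∧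
    ∃ (K : ℝ≥0) (γ : EuclideanSpace ℝ (Fin d) → ℝ), LipschitzWith K γ ∧
      ∀ x ∈ U, x ∈ X ↔ γ (x - ⟪ν, x⟫ • ν) < ⟪ν, x⟫

/-- `n` is the outward unit normal of `X` at `x`: to first order at `x`, the set `X` is the
half-space `{y | ⟪y - x, n⟫ < 0}`. -/
def IsOutwardUnitNormal {d : ℕ} (X : Set (EuclideanSpace ℝ (Fin d)))
    (x n : EuclideanSpace ℝ (Fin d)) : Prop :=
  ‖n‖ = 1 ∧ ∀ ε : ℝ, 0 < ε → ∀ᶠ y in 𝓝 x,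
    (⟪y - x, n⟫ < -(ε * ‖y - x‖) → y ∈ X) ∧ (ε * ‖y - x‖ < ⟪y - x, n⟫ → y ∉ X)

/-- The outward unit normal at a point is unique, so the choice below is no choice. -/
theorem IsOutwardUnitNormal.unique {d : ℕ} {X : Set (EuclideanSpace ℝ (Fin d))}
    {x n m : EuclideanSpace ℝ (Fin d)} (hn : IsOutwardUnitNormal X x n)
    (hm : IsOutwardUnitNormal X x m) : n = m := by
  obtain ⟨hn1, hn⟩ := hn
  obtain ⟨hm1, hm⟩ := hm
  by_contra hne
  have hpos : 0 < ‖n - m‖ := norm_pos_iff.2 (sub_ne_zero.2 hne)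
  have hsq : ‖n - m‖ ^ 2 = 2 - 2 * ⟪n, m⟫ := by
    rw [norm_sub_sq_real, hn1, hm1]; ring
  have h1 : ⟪n - m, n⟫ = ‖n - m‖ ^ 2 / 2 := by
    rw [inner_sub_left, real_inner_self_eq_norm_sq, hn1, real_inner_comm, hsq]; ring
  have h2 : ⟪n - m, m⟫ = -(‖n - m‖ ^ 2 / 2) := by
    rw [inner_sub_left, real_inner_self_eq_norm_sq, hm1, hsq]; ring
  have ht : Tendsto (fun t : ℝ => x + t • (n - m)) (𝓝[>] 0) (𝓝 x) := by
    have : Continuous (fun t : ℝ => x + t • (n - m)) := by fun_prop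
    simpa using (this.tendsto 0).mono_left nhdsWithin_le_nhds
  have hε : 0 < ‖n - m‖ / 4 := by positivity
  obtain ⟨t, ⟨ha, hb⟩, htp⟩ :=
    ((ht.eventually ((hn _ hε).and (hm _ hε))).and self_mem_nhdsWithin).exists
  have htp : 0 < t := htp
  have hlt : ‖n - m‖ / 4 * ‖x + t • (n - m) - x‖ < t * (‖n - m‖ ^ 2 / 2) := by
    rw [add_sub_cancel_left, norm_smul, Real.norm_of_nonneg htp.le]
    nlinarith [mul_pos htp (pow_pos hpos 2)]
  refine ha.2 ?_ (hb.1 ?_)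
  · rw [add_sub_cancel_left] at *
    rw [inner_smul_left, h1]; simpa using hlt
  · rw [add_sub_cancel_left] at *
    rw [inner_smul_left, h2]; simp only [conj_trivial]; linarith

open Classical in
/-- The outward unit normal of `X` at `x`, and `0` at the points where there is none (for a
locally Lipschitz boundary these boundary points have surface measure zero). -/
noncomputable def outwardNormal {d : ℕ} (X : Set (EuclideanSpace ℝ (Fin d)))
    (x : EuclideanSpace ℝ (Fin d)) : EuclideanSpace ℝ (Fin d) :=
  if h : ∃ n, IsOutwardUnitNormal X x n then h.choose else 0

/-- The surface measure on the boundary of `X`: the `(d - 1)`-dimensional Hausdorff measure,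
normalized to agree with Lebesgue measure on hyperplanes. -/
noncomputable def surfaceMeasure {d : ℕ} (X : Set (EuclideanSpace ℝ (Fin d))) :
    Measure (EuclideanSpace ℝ (Fin d)) :=
  (Measure.euclideanHausdorffMeasure (d - 1)).restrict (frontier X)

/-- The flux `∫_{∂X} F · n dS` of the vector field `F` through the boundary of `X`. -/
noncomputable def boundaryFlux {d : ℕ} (X : Set (EuclideanSpace ℝ (Fin d)))
    (F : EuclideanSpace ℝ (Fin d) → EuclideanSpace ℝ (Fin d)) : ℝ :=
  ∫ x, ⟪F x, outwardNormal X x⟫ ∂(surfaceMeasure X)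

/-- The boundary flux of `F` vanishes. If `X` is not the whole space, the flux integral over `∂X`
converges absolutely and is zero; if `X = ℝ^d`, the flux through the sphere of radius `r` around
the origin tends to `0` as `r → ∞`. -/
def VanishingBoundaryFlux {d : ℕ} (X : Set (EuclideanSpace ℝ (Fin d)))
    (F : EuclideanSpace ℝ (Fin d) → EuclideanSpace ℝ (Fin d)) : Prop :=
  (X ≠ univ → Integrable (fun x => ⟪F x, outwardNormal X x⟫) (surfaceMeasure X) ∧
    boundaryFlux X F = 0) ∧
  (X = univ → Tendsto (fun r : ℝ => boundaryFlux (Metric.ball 0 r) F) atTop (𝓝 0))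

/-!
The field `F = q • f` has divergence `q div f + q ⟪f, ∇ log q⟫` on `X`: where `q > 0` this is the
product rule, and where `q = 0` the density has a minimum, so that both sides lose the term with
`∇q`. Hence the claim is the divergence theorem `∫_X div F = ∫_{∂X} F · n dS`
(`integral_divergence_eq_boundaryFlux`) for a field that is integrable on `X`, merely differentiable
inside, and merely continuous up to a Lipschitz boundary. Its proof rests on the following points.

* Cutoffs `χ(x / R)` with `R → ∞` reduce it to `φ • F` with `φ` of compact support, because `F` is
  integrable. This also settles the whole space, where there is no boundary. A partition of unity
  then localizes `φ` near one point of the closure of `X`.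
* Inside `X`, the divergence theorem on boxes in Mathlib asks only for differentiability and an
  integrable divergence. Mollifying the test function instead of the field gives
  `∫_X (φ div F + Dφ(F)) = 0` for every Lipschitz `φ` with compact support in `X`
  (`integral_mul_divergence_add_fderiv_of_tsupport_subset`).
* Near a boundary point, let `h` be the height above the Lipschitz graph that bounds `X`. The
  previous identity for the Lipschitz function `φ · θ(h / ε)`, with `θ` a smooth step, has a
  boundary layer term, which in the coordinates (base point, `h / ε`) converges to the flux of
  `φ • F` against `∇h` by the continuity of `F` up to the boundary
  (`integral_mul_divergence_add_fderiv_of_graph`).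
* The area formula for Lipschitz graphs (`comap_graphMap_euclideanHausdorffMeasure`) says that the
  surface measure has density `√(1 + ‖∇g‖²)` over the base, and this is the length of `∇h`, whose
  direction is that of the inward normal (`isOutwardUnitNormal_graphMap`). It follows from the
  linear case by cutting the base into pieces on which the graph is almost linear.
-/

/-! ### The product rule and the divergence theorem for compactly supported fields -/

theorem divergence_smul {d : ℕ} {φ : EuclideanSpace ℝ (Fin d) → ℝ}
    {F : EuclideanSpace ℝ (Fin d) → EuclideanSpace ℝ (Fin d)} {x : EuclideanSpace ℝ (Fin d)}
    (hφ : DifferentiableAt ℝ φ x) (hF : DifferentiableAt ℝ F x) :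
    divergence (fun y => φ y • F y) x = φ x * divergence F x + fderiv ℝ φ x (F x) := by
  have hx : F x = ∑ i, F x i • EuclideanSpace.single i (1 : ℝ) := by
    have := (EuclideanSpace.basisFun (Fin d) ℝ).sum_repr (F x)
    simpa using this.symm
  have h2 : fderiv ℝ φ x (F x) = ∑ i, fderiv ℝ φ x (EuclideanSpace.single i 1) * F x i := by
    conv_lhs => rw [hx]
    simp [map_sum, mul_comm]
  rw [h2]
  unfold divergence
  rw [fderiv_fun_smul hφ hF, Finset.mul_sum, ← Finset.sum_add_distrib]
  simp

/-- The divergence vanishes in the mean. The field need only be differentiable, not `C¹`: this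
is the strength of the divergence theorem on boxes for the Henstock–Kurzweil integral. -/
theorem integral_divergence_eq_zero {d : ℕ}
    {G : EuclideanSpace ℝ (Fin d) → EuclideanSpace ℝ (Fin d)} (hG : Differentiable ℝ G)
    (hc : HasCompactSupport G) (hi : Integrable (divergence G)) : ∫ x, divergence G x = 0 := by
  cases d with
  | zero => simp [divergence]
  | succ n =>
    obtain ⟨R, hR⟩ := hc.isCompact.isBounded.subset_ball (0 : EuclideanSpace ℝ (Fin (n + 1)))
    have hzero : ∀ x : EuclideanSpace ℝ (Fin (n + 1)), (∃ i, R ≤ |x i|) → G x = 0 := by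
      rintro x ⟨i, hx⟩
      refine image_eq_zero_of_notMem_tsupport fun hmem => ?_
      have h1 := hR hmem
      rw [mem_ball_zero_iff] at h1
      have h2 := PiLp.norm_apply_le x i
      rw [Real.norm_eq_abs] at h2
      linarith
    set R' : ℝ := max R 0
    have hR0 : 0 ≤ R' := le_max_right _ _
    have hRR' : R ≤ R' := le_max_left _ _
    let e : (Fin (n + 1) → ℝ) →L[ℝ] EuclideanSpace ℝ (Fin (n + 1)) :=
      (EuclideanSpace.equiv (Fin (n + 1)) ℝ).symm.toContinuousLinearMap
    have he : ∀ x, e x = WithLp.toLp 2 x := fun x => rfl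
    have hmp : MeasurePreserving e := PiLp.volume_preserving_toLp (Fin (n + 1))
    have hemb : MeasurableEmbedding e :=
      (EuclideanSpace.equiv (Fin (n + 1)) ℝ).symm.toHomeomorph.measurableEmbedding
    let f : Fin (n + 1) → (Fin (n + 1) → ℝ) → ℝ := fun i x => G (e x) i
    let f' : Fin (n + 1) → (Fin (n + 1) → ℝ) → (Fin (n + 1) → ℝ) →L[ℝ] ℝ := fun i x =>
      (EuclideanSpace.proj i).comp ((fderiv ℝ G (e x)).comp e)
    have hf : ∀ i x, HasFDerivAt (f i) (f' i x) x := fun i x =>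
      (EuclideanSpace.proj (𝕜 := ℝ) i).hasFDerivAt.comp x
        ((hG (e x)).hasFDerivAt.comp x e.hasFDerivAt)
    have hdiv : ∀ x, ∑ i, f' i x (Pi.single i 1) = divergence G (e x) := by
      intro x
      simp only [divergence, f', he]
      rfl
    have hint : Integrable (fun x => divergence G (e x)) := (hmp.integrable_comp_emb hemb).2 hi
    have key := integral_divergence_of_hasFDerivAt_off_countable' (fun _ => -R') (fun _ => R')
      (fun _ => by dsimp; linarith) f f' ∅ countable_empty
      (fun i x _ => (hf i x).continuousAt.continuousWithinAt) (fun x _ i => hf i x)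
      (by simp only [hdiv]; exact hint.integrableOn)
    simp only [hdiv] at key
    have hout : ∀ x, x ∉ Icc (fun _ : Fin (n + 1) => -R') (fun _ => R') →
        divergence G (e x) = 0 := by
      intro x hx
      have : ∃ i, R < |x i| := by
        by_contra! hcon
        exact hx ⟨fun i => (abs_le.1 ((hcon i).trans (le_max_left _ _))).1,
          fun i => (abs_le.1 ((hcon i).trans (le_max_left _ _))).2⟩
      obtain ⟨i, hi⟩ := this
      have hnhds : G =ᶠ[𝓝 (e x)] fun _ => 0 := by
        have : ∀ᶠ y : EuclideanSpace ℝ (Fin (n + 1)) in 𝓝 (e x), R < |y i| := by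
          have hc : Continuous fun y : EuclideanSpace ℝ (Fin (n + 1)) => |y i| := by fun_prop
          exact hc.continuousAt.eventually_const_lt hi
        filter_upwards [this] with y hy using hzero y ⟨i, hy.le⟩
      simp [divergence, hnhds.fderiv_eq]
    rw [setIntegral_eq_integral_of_forall_compl_eq_zero hout, hmp.integral_comp hemb] at key
    rw [key]
    refine Finset.sum_eq_zero fun i _ => ?_
    have h1 : ∀ x : Fin n → ℝ, f i (i.insertNth R' x) = 0 := fun x => by
      have := hzero (e (i.insertNth R' x)) ⟨i, by
        simpa [he, abs_of_nonneg hR0] using hRR'⟩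
      simp [f, this]
    have h2 : ∀ x : Fin n → ℝ, f i (i.insertNth (-R') x) = 0 := fun x => by
      have := hzero (e (i.insertNth (-R') x)) ⟨i, by
        simpa [he, abs_of_nonneg hR0] using hRR'⟩
      simp [f, this]
    simp [h1, h2]

/-! ### Integration by parts against differentiable test functions inside the domain -/

section IntegrationByParts

variable {d : ℕ} {X : Set (EuclideanSpace ℝ (Fin d))}
  {F : EuclideanSpace ℝ (Fin d) → EuclideanSpace ℝ (Fin d)}
  {φ : EuclideanSpace ℝ (Fin d) → ℝ} {C : ℝ≥0}

/-- A bounded multiplier does not destroy integrability of the divergence. -/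
theorem integrableOn_mul_divergence (hdiv : IntegrableOn (divergence F) X)
    (hφ : Continuous φ) (hc : HasCompactSupport φ) :
    IntegrableOn (fun x => φ x * divergence F x) X := by
  obtain ⟨M, hM⟩ := hc.exists_bound_of_continuous hφ
  exact Integrable.bdd_mul hdiv hφ.aestronglyMeasurable (ae_of_all _ hM)

/-- The derivative of a Lipschitz test function, paired with a field that is continuous up to the
boundary, is integrable. -/
theorem integrableOn_fderiv_apply (hX : IsOpen X) (hF : ContinuousOn F (closure X))
    (hφ : LipschitzWith C φ) (hc : HasCompactSupport φ) :
    IntegrableOn (fun x => fderiv ℝ φ x (F x)) X := by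
  have hK : IsCompact (tsupport φ ∩ closure X) := hc.isCompact.inter_right isClosed_closure
  obtain ⟨M, hM⟩ := hK.exists_bound_of_continuousOn (hF.mono inter_subset_right)
  have hmeas : AEStronglyMeasurable (fun x => fderiv ℝ φ x (F x)) (volume.restrict X) := by
    have h1 : AEStronglyMeasurable F (volume.restrict X) :=
      (hF.mono subset_closure).aestronglyMeasurable hX.measurableSet
    have h2 : AEStronglyMeasurable (fderiv ℝ φ) (volume.restrict X) :=
      (measurable_fderiv ℝ φ).aestronglyMeasurable
    exact (isBoundedBilinearMap_apply (𝕜 := ℝ)).continuous.comp_aestronglyMeasurable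
      (h2.prodMk h1)
  have hbound : IntegrableOn ((tsupport φ).indicator fun _ => (C : ℝ) * M) X :=
    (((integrableOn_const (hs := hc.isCompact.measure_lt_top.ne)).integrable_indicator
      hc.isCompact.measurableSet)).integrableOn
  refine Integrable.mono' hbound hmeas ?_
  refine (ae_restrict_iff' hX.measurableSet).2 (ae_of_all _ fun x hx => ?_)
  by_cases hxt : x ∈ tsupport φ
  · rw [indicator_of_mem hxt]
    refine ((fderiv ℝ φ x).le_opNorm _).trans ?_
    gcongr
    · exact norm_fderiv_le_of_lipschitz ℝ hφ
    · exact hM x ⟨hxt, subset_closure hx⟩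
  · rw [indicator_of_notMem hxt, (notMem_tsupport_iff_eventuallyEq.1 hxt).fderiv_eq]
    simp

theorem integral_mul_divergence_add_fderiv_of_differentiable (hX : IsOpen X)
    (hF : ContinuousOn F (closure X)) (hFd : DifferentiableOn ℝ F X)
    (hdiv : IntegrableOn (divergence F) X) (hφ : LipschitzWith C φ) (hφd : Differentiable ℝ φ)
    (hc : HasCompactSupport φ) (hsub : tsupport φ ⊆ X) :
    ∫ x in X, (φ x * divergence F x + fderiv ℝ φ x (F x)) = 0 := by
  set G : EuclideanSpace ℝ (Fin d) → EuclideanSpace ℝ (Fin d) := fun x => φ x • F x with hGdef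
  have hout : ∀ x, x ∉ X → G =ᶠ[𝓝 x] fun _ => 0 := fun x hx => by
    filter_upwards [notMem_tsupport_iff_eventuallyEq.1 fun h => hx (hsub h)] with y hy
    simp [G, hy]
  have hin : ∀ x ∈ X, divergence G x = φ x * divergence F x + fderiv ℝ φ x (F x) := fun x hx =>
    divergence_smul (hφd x) ((hFd x hx).differentiableAt (hX.mem_nhds hx))
  have hG : Differentiable ℝ G := fun x => by
    by_cases hx : x ∈ X
    · exact (hφd x).smul ((hFd x hx).differentiableAt (hX.mem_nhds hx))
    · exact (differentiableAt_const _).congr_of_eventuallyEq (hout x hx)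
  have hG0 : ∀ x, x ∉ X → divergence G x = 0 := fun x hx => by
    simp [divergence, (hout x hx).fderiv_eq]
  have hint : IntegrableOn (divergence G) X :=
    ((integrableOn_mul_divergence hdiv hφ.continuous hc).add
      (integrableOn_fderiv_apply hX hF hφ hc)).congr_fun (fun x hx => (hin x hx).symm)
      hX.measurableSet
  rw [← setIntegral_congr_fun hX.measurableSet hin,
    setIntegral_eq_integral_of_forall_compl_eq_zero hG0]
  refine integral_divergence_eq_zero hG (hc.smul_right (f' := F)) ?_
  rwa [← integrableOn_iff_integrable_of_support_subset (s := X)]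
  intro x hx
  by_contra h
  exact hx (hG0 x h)

end IntegrationByParts

/-! ### Mollification of Lipschitz functions -/

section Mollification

open ContinuousLinearMap
open scoped Convolution

variable {E : Type*} [NormedAddCommGroup E] [InnerProductSpace ℝ E] [FiniteDimensional ℝ E]
  [MeasurableSpace E] [BorelSpace E] {φ : E → ℝ} {C : ℝ≥0}

/-- Mollification commutes with differentiation, the derivative of a Lipschitz function being
understood almost everywhere. -/
theorem LipschitzWith.hasFDerivAt_normed_convolution (hφ : LipschitzWith C φ)
    (b : ContDiffBump (0 : E)) (x : E) :
    HasFDerivAt (b.normed volume ⋆[lsmul ℝ ℝ] φ)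
      ((b.normed volume ⋆[lsmul ℝ ℝ] fderiv ℝ φ) x) x := by
  have hb : Continuous (b.normed (volume : Measure E)) := b.continuous_normed
  have hbi : Integrable (b.normed (volume : Measure E)) := b.integrable_normed
  have hmp : MeasurePreserving (fun t : E => x - t) := Measure.measurePreserving_sub_left volume x
  have hdiff : ∀ᵐ t : E, DifferentiableAt ℝ φ (x - t) :=
    hmp.quasiMeasurePreserving.ae hφ.ae_differentiableAt
  have hsup : HasCompactSupport (b.normed (volume : Measure E)) := b.hasCompactSupport_normed
  refine (hasFDerivAt_integral_of_dominated_loc_of_lip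
    (F := fun y t => lsmul ℝ ℝ (b.normed volume t) (φ (y - t)))
    (F' := fun t => lsmul ℝ ℝ (b.normed volume t) (fderiv ℝ φ (x - t)))
    (bound := fun t => b.normed volume t * C) univ_mem ?_ ?_ ?_ ?_ ?_ ?_).2
  · refine Eventually.of_forall fun y => Continuous.aestronglyMeasurable ?_
    have := hφ.continuous
    simp only [lsmul_apply]
    fun_prop
  · refine Continuous.integrable_of_hasCompactSupport ?_ ?_
    · have := hφ.continuous
      simp only [lsmul_apply]
      fun_prop
    · exact hsup.smul_right (f' := fun t => φ (x - t))
  · simp only [lsmul_apply]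
    exact (hb.measurable.smul ((measurable_fderiv ℝ φ).comp
      (measurable_const.sub measurable_id))).aestronglyMeasurable
  · refine ae_of_all _ fun t => LipschitzWith.lipschitzOnWith (s := univ) ?_
    refine LipschitzWith.of_dist_le_mul fun y z => ?_
    have h0 : 0 ≤ b.normed volume t := b.nonneg_normed t
    have h1 : dist (φ (y - t)) (φ (z - t)) ≤ C * dist y z := by
      simpa using hφ.dist_le_mul (y - t) (z - t)
    simp only [lsmul_apply, smul_eq_mul, Real.dist_eq, ← mul_sub, abs_mul, abs_of_nonneg h0]
    rw [Real.coe_nnabs, abs_of_nonneg (mul_nonneg h0 C.coe_nonneg), mul_assoc]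
    exact mul_le_mul_of_nonneg_left h1 h0
  · exact hbi.mul_const _
  · filter_upwards [hdiff] with t ht
    simp only [lsmul_apply]
    have := ht.hasFDerivAt.comp x ((hasFDerivAt_id x).sub_const t)
    exact (this.const_smul (b.normed volume t))

theorem LipschitzWith.normed_convolution (hφ : LipschitzWith C φ) (b : ContDiffBump (0 : E)) :
    LipschitzWith C (b.normed volume ⋆[lsmul ℝ ℝ] φ) := by
  refine lipschitzWith_of_nnnorm_fderiv_le
    (fun x => (hφ.hasFDerivAt_normed_convolution b x).differentiableAt) fun x => ?_
  rw [(hφ.hasFDerivAt_normed_convolution b x).fderiv, ← NNReal.coe_le_coe, coe_nnnorm]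
  have hbi : Integrable (b.normed (volume : Measure E)) := b.integrable_normed
  refine (norm_integral_le_of_norm_le (hbi.mul_const (C : ℝ)) (ae_of_all _ fun t => ?_)).trans ?_
  · rw [lsmul_apply, norm_smul, Real.norm_of_nonneg (b.nonneg_normed t)]
    gcongr
    · exact b.nonneg_normed t
    · exact norm_fderiv_le_of_lipschitz ℝ hφ
  · rw [integral_mul_const, b.integral_normed, one_mul]

end Mollification

/-! ### Integration by parts against Lipschitz functions -/

section IntegrationByParts

open ContinuousLinearMap
open scoped Convolution

variable {d : ℕ} {X : Set (EuclideanSpace ℝ (Fin d))}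
  {F : EuclideanSpace ℝ (Fin d) → EuclideanSpace ℝ (Fin d)}
  {φ : EuclideanSpace ℝ (Fin d) → ℝ} {C : ℝ≥0}

/-- Integration by parts against a Lipschitz function with compact support inside `X`, obtained
from the differentiable case by mollifying the test function: no regularity of `F` is used beyond
pointwise differentiability. -/
theorem integral_mul_divergence_add_fderiv_of_tsupport_subset (hX : IsOpen X)
    (hF : ContinuousOn F (closure X)) (hFd : DifferentiableOn ℝ F X)
    (hdiv : IntegrableOn (divergence F) X) (hφ : LipschitzWith C φ)
    (hc : HasCompactSupport φ) (hsub : tsupport φ ⊆ X) :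
    ∫ x in X, (φ x * divergence F x + fderiv ℝ φ x (F x)) = 0 := by
  obtain ⟨δ, hδ, hδX⟩ := hc.isCompact.exists_cthickening_subset_open hX hsub
  set K := Metric.cthickening δ (tsupport φ) with hK
  have hKc : IsCompact K := hc.isCompact.cthickening
  let b : ℕ → ContDiffBump (0 : EuclideanSpace ℝ (Fin d)) := fun k =>
    ⟨δ / (k + 1) / 2, δ / (k + 1), by positivity, half_lt_self (by positivity)⟩
  have hb : ∀ k, (b k).rOut = δ / (k + 1) := fun k => rfl
  have hbδ : ∀ k, (b k).rOut ≤ δ := fun k => by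
    rw [hb]
    exact div_le_self hδ.le (by linarith [(Nat.cast_nonneg k : (0 : ℝ) ≤ k)])
  have hb0 : Tendsto (fun k => (b k).rOut) atTop (𝓝 0) := by
    simp only [hb]
    have := (tendsto_one_div_add_atTop_nhds_zero_nat (𝕜 := ℝ)).const_mul δ
    simpa [div_eq_mul_inv] using this
  let ψ : ℕ → EuclideanSpace ℝ (Fin d) → ℝ := fun k => (b k).normed volume ⋆[lsmul ℝ ℝ] φ
  have hψK : ∀ k, tsupport (ψ k) ⊆ K := fun k => by
    refine closure_minimal ?_ hKc.isClosed
    refine (support_convolution_subset (L := lsmul ℝ ℝ)).trans ?_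
    rw [(b k).support_normed_eq]
    rintro _ ⟨u, hu, v, hv, rfl⟩
    refine Metric.mem_cthickening_of_dist_le _ v _ _ (subset_tsupport _ hv) ?_
    simp only [dist_add_self_left]
    exact (mem_ball_zero_iff.1 hu).le.trans (hbδ k)
  have hψc : ∀ k, HasCompactSupport (ψ k) := fun k =>
    hKc.of_isClosed_subset (isClosed_tsupport _) (hψK k)
  have hψL : ∀ k, LipschitzWith C (ψ k) := fun k => hφ.normed_convolution (b k)
  have hzero := fun k => integral_mul_divergence_add_fderiv_of_differentiable hX hF hFd hdiv
    (hψL k) (fun x => (hφ.hasFDerivAt_normed_convolution (b k) x).differentiableAt) (hψc k)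
    ((hψK k).trans hδX)
  obtain ⟨M, hM⟩ := hKc.exists_bound_of_continuousOn
    (hF.mono (hδX.trans subset_closure))
  obtain ⟨M', hM'⟩ := hc.exists_bound_of_continuous hφ.continuous
  have hae : ∀ᵐ x : EuclideanSpace ℝ (Fin d),
      Tendsto (fun k => fderiv ℝ (ψ k) x) atTop (𝓝 (fderiv ℝ φ x)) := by
    have hloc : LocallyIntegrable (fderiv ℝ φ) (volume : Measure (EuclideanSpace ℝ (Fin d))) := by
      have : MemLp (fderiv ℝ φ) ∞ (volume : Measure (EuclideanSpace ℝ (Fin d))) :=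
        memLp_top_of_bound (measurable_fderiv ℝ φ).aestronglyMeasurable C
          (ae_of_all _ fun x => norm_fderiv_le_of_lipschitz ℝ hφ)
      exact this.locallyIntegrable le_top
    filter_upwards [ContDiffBump.ae_convolution_tendsto_right_of_locallyIntegrable
      (K := 2) hb0 (Eventually.of_forall fun k => by simp [b]; linarith) hloc] with x hx
    refine hx.congr fun k => ?_
    exact (hφ.hasFDerivAt_normed_convolution (b k) x).fderiv.symm
  have hlim : Tendsto (fun k => ∫ x in X, (ψ k x * divergence F x + fderiv ℝ (ψ k) x (F x)))
      atTop (𝓝 (∫ x in X, (φ x * divergence F x + fderiv ℝ φ x (F x)))) := by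
    refine tendsto_integral_of_dominated_convergence
      (fun x => (M' + C * δ) * ‖divergence F x‖ + K.indicator (fun _ => C * M) x)
      (fun k => ((integrableOn_mul_divergence hdiv (hψL k).continuous (hψc k)).add
        (integrableOn_fderiv_apply hX hF (hψL k) (hψc k))).aestronglyMeasurable) ?_ ?_ ?_
    · exact (hdiv.norm.const_mul _).add
        ((((integrableOn_const (hs := hKc.measure_lt_top.ne)).integrable_indicator
          hKc.measurableSet)).integrableOn)
    · intro k
      refine ae_of_all _ fun x => (norm_add_le _ _).trans (add_le_add ?_ ?_)
      · rw [norm_mul]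
        gcongr
        have h1 : dist (ψ k x) (φ x) ≤ C * δ :=
          (b k).dist_normed_convolution_le hφ.continuous.aestronglyMeasurable fun y hy => by
            refine (hφ.dist_le_mul y x).trans ?_
            gcongr
            exact (Metric.mem_ball.1 hy).le.trans (hbδ k)
        calc ‖ψ k x‖ ≤ ‖φ x‖ + dist (ψ k x) (φ x) := by
              rw [dist_eq_norm]
              simpa using norm_add_le (φ x) (ψ k x - φ x)
          _ ≤ M' + C * δ := add_le_add (hM' x) h1
      · by_cases hx : x ∈ K
        · rw [indicator_of_mem hx]
          refine ((fderiv ℝ (ψ k) x).le_opNorm _).trans ?_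
          gcongr
          · exact norm_fderiv_le_of_lipschitz ℝ (hψL k)
          · exact hM x hx
        · rw [indicator_of_notMem hx,
            (notMem_tsupport_iff_eventuallyEq.1 fun h => hx (hψK k h)).fderiv_eq]
          simp
    · refine ae_restrict_of_ae ?_
      filter_upwards [hae] with x hx
      have h1 : Tendsto (fun k => ψ k x) atTop (𝓝 (φ x)) :=
        ContDiffBump.convolution_tendsto_right_of_continuous hb0 hφ.continuous x
      exact (h1.mul_const _).add ((ContinuousLinearMap.apply ℝ ℝ (F x)).continuous.tendsto _
        |>.comp hx)
  simp only [hzero] at hlim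
  exact (tendsto_nhds_unique hlim tendsto_const_nhds)

end IntegrationByParts

/-! ### Graphs over a hyperplane and their surface measure -/

section Graph

variable {E : Type*} [NormedAddCommGroup E] [InnerProductSpace ℝ E] {ν : E}

/-- The parametrization `y ↦ y + g y • ν` of the graph of a function `g` on the hyperplane
orthogonal to `ν`. -/
def graphMap (ν : E) (g : (ℝ ∙ ν)ᗮ → ℝ) (y : (ℝ ∙ ν)ᗮ) : E := y + g y • ν

/-- The derivative `v ↦ v + L v • ν` of the parametrization of a graph, at a point where the
function has derivative `L`. -/
noncomputable def graphLinear (ν : E) (L : (ℝ ∙ ν)ᗮ →L[ℝ] ℝ) : (ℝ ∙ ν)ᗮ →L[ℝ] E :=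
  (ℝ ∙ ν)ᗮ.subtypeL + L.smulRight ν

theorem inner_normal_coe_orthogonal (y : (ℝ ∙ ν)ᗮ) : ⟪ν, (y : E)⟫ = 0 :=
  Submodule.mem_orthogonal_singleton_iff_inner_right.1 y.2

theorem inner_coe_orthogonal_normal (y : (ℝ ∙ ν)ᗮ) : ⟪(y : E), ν⟫ = 0 :=
  Submodule.mem_orthogonal_singleton_iff_inner_left.1 y.2

theorem inner_coe_add_smul (hν : ‖ν‖ = 1) (v w : (ℝ ∙ ν)ᗮ) (a b : ℝ) :
    ⟪(v : E) + a • ν, (w : E) + b • ν⟫ = ⟪v, w⟫ + a * b := by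
  simp [inner_add_left, inner_add_right, inner_smul_left, inner_smul_right,
    inner_normal_coe_orthogonal, inner_coe_orthogonal_normal, hν, mul_comm]

theorem norm_le_norm_coe_add_smul (v : (ℝ ∙ ν)ᗮ) (a : ℝ) : ‖v‖ ≤ ‖(v : E) + a • ν‖ := by
  have h : ‖(v : E) + a • ν‖ ^ 2 = ‖v‖ ^ 2 + ‖a • ν‖ ^ 2 := by
    have := norm_add_sq_eq_norm_sq_add_norm_sq_of_inner_eq_zero (v : E) (a • ν)
      (by rw [inner_smul_right, inner_coe_orthogonal_normal, mul_zero])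
    simpa [pow_two] using this
  exact le_of_sq_le_sq (by rw [h]; nlinarith [sq_nonneg ‖a • ν‖]) (norm_nonneg _)

theorem graphMap_injective (g : (ℝ ∙ ν)ᗮ → ℝ) : Function.Injective (graphMap ν g) := by
  intro y z h
  have h1 : ‖y - z‖ ≤ ‖((y - z : (ℝ ∙ ν)ᗮ) : E) + (g y - g z) • ν‖ :=
    norm_le_norm_coe_add_smul _ _
  have h2 : ((y - z : (ℝ ∙ ν)ᗮ) : E) + (g y - g z) • ν = 0 := by
    rw [← sub_eq_zero.2 h]
    simp only [graphMap, Submodule.coe_sub, sub_smul]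
    abel
  rw [h2, norm_zero] at h1
  exact sub_eq_zero.1 (norm_le_zero_iff.1 h1)

theorem hasFDerivAt_graphMap {g : (ℝ ∙ ν)ᗮ → ℝ} {L : (ℝ ∙ ν)ᗮ →L[ℝ] ℝ} {y : (ℝ ∙ ν)ᗮ}
    (h : HasFDerivAt g L y) : HasFDerivAt (graphMap ν g) (graphLinear ν L) y :=
  ((ℝ ∙ ν)ᗮ.subtypeL.hasFDerivAt).add (h.smul_const ν)

theorem lipschitzWith_graphMap {K : ℝ≥0} {g : (ℝ ∙ ν)ᗮ → ℝ} (hg : LipschitzWith K g) :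
    LipschitzWith (1 + K * ‖ν‖₊) (graphMap ν g) := by
  refine LipschitzWith.add (LipschitzWith.subtype_val _) (LipschitzWith.of_dist_le_mul ?_)
  intro y z
  rw [dist_eq_norm, ← sub_smul, norm_smul, ← dist_eq_norm, NNReal.coe_mul, coe_nnnorm]
  nlinarith [hg.dist_le_mul y z, norm_nonneg ν]

/-- The Gram determinant of the graph of a linear form: it is the determinant of a rank-one
perturbation of the identity. -/
theorem normDet_graphLinear [FiniteDimensional ℝ E] (hν : ‖ν‖ = 1) (L : (ℝ ∙ ν)ᗮ →L[ℝ] ℝ) :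
    (graphLinear ν L).toLinearMap.normDet = √(1 + ‖L‖ ^ 2) := by
  set u := (InnerProductSpace.toDual ℝ (ℝ ∙ ν)ᗮ).symm L with hu
  have hL : ∀ v, ⟪u, v⟫ = L v := fun v => by simp [hu]
  have hnorm : L u = ‖L‖ ^ 2 := by
    rw [← hL, real_inner_self_eq_norm_sq, hu, LinearIsometryEquiv.norm_map]
  have hcomp : LinearMap.adjoint (graphLinear ν L).toLinearMap ∘ₗ (graphLinear ν L).toLinearMap
      = LinearMap.transvection L.toLinearMap u := by
    refine LinearMap.ext fun v => ext_inner_right ℝ fun w => ?_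
    rw [LinearMap.comp_apply, LinearMap.adjoint_inner_left]
    change ⟪(v : E) + L v • ν, (w : E) + L w • ν⟫ = ⟪v + L v • u, w⟫
    rw [inner_coe_add_smul hν, inner_add_left, inner_smul_left, hL]
    simp
  have h := LinearMap.normDet_sq (graphLinear ν L).toLinearMap
  rw [hcomp, LinearMap.transvection.det] at h
  have h' : (graphLinear ν L).toLinearMap.normDet ^ 2 = 1 + ‖L‖ ^ 2 := by
    rw [← hnorm]
    exact_mod_cast h
  rw [← h', Real.sqrt_sq (LinearMap.normDet_nonneg _)]

/-- The density `√(1 + ‖∇g‖²)` of the surface measure of the graph of `g`. -/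
noncomputable def graphDensity (g : (ℝ ∙ ν)ᗮ → ℝ) (y : (ℝ ∙ ν)ᗮ) : ℝ :=
  √(1 + ‖fderiv ℝ g y‖ ^ 2)

theorem one_le_graphDensity (g : (ℝ ∙ ν)ᗮ → ℝ) (y : (ℝ ∙ ν)ᗮ) : 1 ≤ graphDensity g y := by
  rw [graphDensity, Real.one_le_sqrt]
  nlinarith [sq_nonneg ‖fderiv ℝ g y‖]

theorem measurable_graphDensity [MeasurableSpace E] [BorelSpace E] (g : (ℝ ∙ ν)ᗮ → ℝ) : Measurable (graphDensity g) := by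
  unfold graphDensity
  have := (measurable_fderiv ℝ g).norm
  fun_prop

end Graph

/-- If `a` contracts distances relative to `b` up to the factor `C`, then so does it for Hausdorff
measures of images. -/
theorem euclideanHausdorffMeasure_image_le_of_dist_le {U Y Z : Type*} [MetricSpace Y]
    [MetricSpace Z] [MeasurableSpace Y] [BorelSpace Y] [MeasurableSpace Z] [BorelSpace Z] (m : ℕ)
    {a : U → Y} {b : U → Z} {s : Set U} {C : ℝ≥0}
    (h : ∀ x ∈ s, ∀ y ∈ s, dist (a x) (a y) ≤ C * dist (b x) (b y)) :
    (μHE[m] : Measure Y) (a '' s) ≤ (C : ℝ≥0∞) ^ m * (μHE[m] : Measure Z) (b '' s) := by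
  rcases s.eq_empty_or_nonempty with rfl | ⟨x₀, hx₀⟩
  · simp
  have : Nonempty U := ⟨x₀⟩
  let k : Z → Y := a ∘ Function.invFunOn b s
  have hk : ∀ x ∈ s, k (b x) = a x := fun x hx => by
    have hmem : Function.invFunOn b s (b x) ∈ s := Function.invFunOn_mem ⟨x, hx, rfl⟩
    have heq : b (Function.invFunOn b s (b x)) = b x := Function.invFunOn_eq ⟨x, hx, rfl⟩
    have := h _ hmem _ hx
    rw [heq, dist_self, mul_zero] at this
    exact dist_le_zero.1 this
  have hlip : LipschitzOnWith C k (b '' s) := by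
    refine LipschitzOnWith.of_dist_le_mul ?_
    rintro _ ⟨x, hx, rfl⟩ _ ⟨y, hy, rfl⟩
    rw [hk x hx, hk y hy]
    exact h x hx y hy
  have himg : k '' (b '' s) = a '' s := by
    rw [image_image]
    exact image_congr hk
  have := hlip.hausdorffMeasure_image_le (d := m) (by positivity)
  rw [himg, ENNReal.rpow_natCast] at this
  simp only [Measure.euclideanHausdorffMeasure_def, Measure.smul_apply]
  rw [mul_smul_comm]
  gcongr

section AreaFormula

variable {E : Type*} [NormedAddCommGroup E] [InnerProductSpace ℝ E] {ν : E}
  [FiniteDimensional ℝ E] [MeasurableSpace E] [BorelSpace E] {K : ℝ≥0} {g : (ℝ ∙ ν)ᗮ → ℝ}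

/-- Where the graph of `g` is close to that of the linear form `L`, the two have comparable surface
measures. -/
theorem ApproximatesLinearOn.graphMap_measure_le (hν : ‖ν‖ = 1) {L : (ℝ ∙ ν)ᗮ →L[ℝ] ℝ}
    {s : Set (ℝ ∙ ν)ᗮ} {δ : ℝ≥0} (hδ : δ < 1)
    (h : ApproximatesLinearOn (graphMap ν g) (graphLinear ν L) s δ) :
    μHE[Module.finrank ℝ (ℝ ∙ ν)ᗮ] (graphMap ν g '' s) ≤
        ((1 + δ : ℝ≥0) : ℝ≥0∞) ^ Module.finrank ℝ (ℝ ∙ ν)ᗮ *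
          (ENNReal.ofReal √(1 + ‖L‖ ^ 2) * volume s) ∧
      ENNReal.ofReal √(1 + ‖L‖ ^ 2) * volume s ≤
        (((1 - δ)⁻¹ : ℝ≥0) : ℝ≥0∞) ^ Module.finrank ℝ (ℝ ∙ ν)ᗮ *
          μHE[Module.finrank ℝ (ℝ ∙ ν)ᗮ] (graphMap ν g '' s) := by
  have himg : μHE[Module.finrank ℝ (ℝ ∙ ν)ᗮ] (graphLinear ν L '' s) =
      ENNReal.ofReal √(1 + ‖L‖ ^ 2) * volume s := by
    rw [← normDet_graphLinear hν]
    exact LinearMap.euclideanHausdorffMeasure_image_eq_normDet_mul_volume _ s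
  have hexp : ∀ v, ‖v‖ ≤ ‖graphLinear ν L v‖ := fun v => norm_le_norm_coe_add_smul v (L v)
  have hclose : ∀ x ∈ s, ∀ y ∈ s, ‖graphMap ν g x - graphMap ν g y - graphLinear ν L (x - y)‖ ≤
      δ * ‖graphLinear ν L (x - y)‖ := fun x hx y hy =>
    (h x hx y hy).trans (by gcongr; exact hexp _)
  rw [← himg]
  constructor
  · refine euclideanHausdorffMeasure_image_le_of_dist_le _ fun x hx y hy => ?_
    rw [dist_eq_norm, dist_eq_norm, ← map_sub, NNReal.coe_add, NNReal.coe_one, add_mul, one_mul]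
    have := norm_add_le (graphLinear ν L (x - y))
      (graphMap ν g x - graphMap ν g y - graphLinear ν L (x - y))
    rw [add_sub_cancel] at this
    linarith [hclose x hx y hy]
  · refine euclideanHausdorffMeasure_image_le_of_dist_le _ fun x hx y hy => ?_
    have hδ' : (0 : ℝ) < 1 - δ := by
      have : (δ : ℝ) < 1 := by exact_mod_cast hδ
      linarith
    rw [dist_eq_norm, dist_eq_norm, ← map_sub, NNReal.coe_inv, NNReal.coe_sub hδ.le,
      NNReal.coe_one, inv_mul_eq_div, le_div_iff₀ hδ']
    have := norm_sub_le (graphMap ν g x - graphMap ν g y)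
      (graphMap ν g x - graphMap ν g y - graphLinear ν L (x - y))
    rw [sub_sub_cancel] at this
    linarith [hclose x hx y hy]

theorem measurableEmbedding_graphMap (hg : LipschitzWith K g) :
    MeasurableEmbedding (graphMap ν g) :=
  (lipschitzWith_graphMap hg).continuous.measurableEmbedding (graphMap_injective g)

/-- A set of differentiability points is cut into countably many pieces, on each of which the graph
is almost linear and the density almost constant. -/
theorem exists_partition_graphMap (g : (ℝ ∙ ν)ᗮ → ℝ) {δ : ℝ≥0} (hδ : 0 < δ)
    {s : Set (ℝ ∙ ν)ᗮ} (hs : MeasurableSet s) (hd : ∀ y ∈ s, DifferentiableAt ℝ g y) :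
    ∃ (B : ℕ × ℕ → Set (ℝ ∙ ν)ᗮ) (L : ℕ × ℕ → (ℝ ∙ ν)ᗮ →L[ℝ] ℝ),
      Pairwise (Function.onFun Disjoint B) ∧ (∀ i, MeasurableSet (B i)) ∧ s = ⋃ i, B i ∧
      ∀ i, ApproximatesLinearOn (graphMap ν g) (graphLinear ν (L i)) (B i) δ ∧
        ∀ y ∈ B i, |√(1 + ‖L i‖ ^ 2) - graphDensity g y| ≤ δ := by
  have hδ' : (0 : ℝ) < δ := hδ
  -- the level sets of the density, in steps of length `δ`
  let S : ℕ → Set (ℝ ∙ ν)ᗮ := fun k => s ∩ {y | ⌊graphDensity g y / δ⌋₊ = k}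
  have hSm : ∀ k, MeasurableSet (S k) := fun k =>
    hs.inter ((Nat.measurable_floor.comp ((measurable_graphDensity g).div_const _))
      (measurableSet_singleton k))
  have hS : ∀ k, ∀ y ∈ S k, (k : ℝ) * δ ≤ graphDensity g y ∧
      graphDensity g y < (k + 1) * δ := by
    rintro k y ⟨-, rfl⟩
    have h0 : 0 ≤ graphDensity g y / δ :=
      div_nonneg (zero_le_one.trans (one_le_graphDensity g y)) hδ'.le
    exact ⟨(le_div_iff₀ hδ').1 (Nat.floor_le h0), (div_lt_iff₀ hδ').1 (Nat.lt_floor_add_one _)⟩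
  have key := fun k => exists_partition_approximatesLinearOn_of_hasFDerivWithinAt
    (graphMap ν g) (S k) (fun y => graphLinear ν (fderiv ℝ g y))
    (fun y hy => (hasFDerivAt_graphMap (hd y hy.1).hasFDerivAt).hasFDerivWithinAt)
    (fun _ => δ) (fun _ => hδ.ne')
  choose t A htd htm htc hta htn using key
  have hL : ∀ i : ℕ × ℕ, ∃ L : (ℝ ∙ ν)ᗮ →L[ℝ] ℝ,
      ApproximatesLinearOn (graphMap ν g) (graphLinear ν L) (S i.1 ∩ t i.1 i.2) δ ∧
        ∀ y ∈ S i.1 ∩ t i.1 i.2, |√(1 + ‖L‖ ^ 2) - graphDensity g y| ≤ δ := by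
    rintro ⟨k, n⟩
    rcases (S k).eq_empty_or_nonempty with he | hne
    · exact ⟨0, by simp [he], by simp [he]⟩
    · obtain ⟨z, hz, hA⟩ := htn k hne n
      refine ⟨fderiv ℝ g z, hA ▸ hta k n, fun y hy => ?_⟩
      have h1 := hS k y hy.1
      have h2 := hS k z hz
      rw [graphDensity] at h2
      rw [abs_le]
      constructor <;> linarith [h1.1, h1.2, h2.1, h2.2]
  choose L hLa hLd using hL
  refine ⟨fun i => S i.1 ∩ t i.1 i.2, L, ?_, fun i => (hSm _).inter (htm _ _), ?_,
    fun i => ⟨hLa i, hLd i⟩⟩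
  · rintro ⟨k, n⟩ ⟨k', n'⟩ hne
    rcases eq_or_ne k k' with rfl | hk
    · have hn : n ≠ n' := fun h => hne (by rw [h])
      exact (htd k hn).mono inter_subset_right inter_subset_right
    · refine Set.disjoint_left.2 fun y hy hy' => hk ?_
      exact hy.1.2.symm.trans hy'.1.2
  · ext y
    simp only [mem_iUnion]
    constructor
    · intro hy
      have hyS : y ∈ S ⌊graphDensity g y / δ⌋₊ := ⟨hy, rfl⟩
      obtain ⟨n, hn⟩ := mem_iUnion.1 (htc _ hyS)
      exact ⟨(_, n), hyS, hn⟩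
    · rintro ⟨i, hi⟩
      exact hi.1.1

/-- The area formula, up to a factor that tends to `1` with `δ`. -/
theorem comap_graphMap_comparable (hν : ‖ν‖ = 1) (hg : LipschitzWith K g) {δ : ℝ≥0} (hδ : 0 < δ)
    (hδ1 : δ < 1) {s : Set (ℝ ∙ ν)ᗮ} (hs : MeasurableSet s)
    (hd : ∀ y ∈ s, DifferentiableAt ℝ g y) :
    (μHE[Module.finrank ℝ (ℝ ∙ ν)ᗮ].comap (graphMap ν g)) s ≤
        (((1 + δ) ^ (Module.finrank ℝ (ℝ ∙ ν)ᗮ + 1) : ℝ≥0) : ℝ≥0∞) *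
          (volume.withDensity fun y => ENNReal.ofReal (graphDensity g y)) s ∧
      (volume.withDensity fun y => ENNReal.ofReal (graphDensity g y)) s ≤
        (((1 - δ)⁻¹ ^ Module.finrank ℝ (ℝ ∙ ν)ᗮ * (1 + δ) : ℝ≥0) : ℝ≥0∞) *
          (μHE[Module.finrank ℝ (ℝ ∙ ν)ᗮ].comap (graphMap ν g)) s := by
  obtain ⟨B, L, hBd, hBm, hsB, hB⟩ := exists_partition_graphMap g hδ hs hd
  have hdens : ∀ i, ∀ y ∈ B i,
      √(1 + ‖L i‖ ^ 2) ≤ (1 + δ) * graphDensity g y ∧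
        graphDensity g y ≤ (1 + δ) * √(1 + ‖L i‖ ^ 2) := by
    intro i y hy
    have h1 := abs_le.1 ((hB i).2 y hy)
    have h2 := one_le_graphDensity g y
    have h3 : 1 ≤ √(1 + ‖L i‖ ^ 2) := Real.one_le_sqrt.2 (by nlinarith [sq_nonneg ‖L i‖])
    have hδ0 : (0 : ℝ) ≤ δ := δ.coe_nonneg
    constructor <;> nlinarith [h1.1, h1.2]
  have hofReal : ∀ x : ℝ, ENNReal.ofReal ((1 + δ) * x) = ((1 + δ : ℝ≥0) : ℝ≥0∞) *
      ENNReal.ofReal x := fun x => by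
    rw [ENNReal.ofReal_mul (by positivity), ← ENNReal.ofReal_coe_nnreal]
    push_cast
    rfl
  have hup : ∀ i, ENNReal.ofReal √(1 + ‖L i‖ ^ 2) * volume (B i) ≤ ((1 + δ : ℝ≥0) : ℝ≥0∞) *
      (volume.withDensity fun y => ENNReal.ofReal (graphDensity g y)) (B i) := fun i => by
    rw [withDensity_apply _ (hBm i), ← setLIntegral_const, ← lintegral_const_mul' _ _ (by simp)]
    refine setLIntegral_mono' (hBm i) fun y hy => ?_
    rw [← hofReal]
    exact ENNReal.ofReal_le_ofReal (hdens i y hy).1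
  have hdown : ∀ i, (volume.withDensity fun y => ENNReal.ofReal (graphDensity g y)) (B i) ≤
      ((1 + δ : ℝ≥0) : ℝ≥0∞) * (ENNReal.ofReal √(1 + ‖L i‖ ^ 2) * volume (B i)) := fun i => by
    rw [withDensity_apply _ (hBm i), ← mul_assoc, ← hofReal, ← setLIntegral_const]
    exact setLIntegral_mono' (hBm i) fun y hy => ENNReal.ofReal_le_ofReal (hdens i y hy).2
  have hemb := measurableEmbedding_graphMap (ν := ν) hg
  rw [hsB, measure_iUnion hBd hBm, measure_iUnion hBd hBm, ← ENNReal.tsum_mul_left,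
    ← ENNReal.tsum_mul_left]
  constructor
  · refine ENNReal.tsum_le_tsum fun i => ?_
    rw [hemb.comap_apply]
    refine ((hB i).1.graphMap_measure_le hν hδ1).1.trans ?_
    rw [pow_succ (1 + δ), ENNReal.coe_mul, ENNReal.coe_pow, mul_assoc]
    exact mul_le_mul_right (hup i) _
  · refine ENNReal.tsum_le_tsum fun i => ?_
    rw [hemb.comap_apply, ENNReal.coe_mul, ENNReal.coe_pow, mul_comm (_ ^ _), mul_assoc]
    refine (hdown i).trans ?_
    exact mul_le_mul_right ((hB i).1.graphMap_measure_le hν hδ1).2 _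

/-- The area formula for Lipschitz graphs. -/
theorem comap_graphMap_euclideanHausdorffMeasure (hν : ‖ν‖ = 1) (hg : LipschitzWith K g) :
    μHE[Module.finrank ℝ (ℝ ∙ ν)ᗮ].comap (graphMap ν g) =
      volume.withDensity fun y => ENNReal.ofReal (graphDensity g y) := by
  set m := Module.finrank ℝ (ℝ ∙ ν)ᗮ
  have hemb := measurableEmbedding_graphMap (ν := ν) hg
  have hDm : MeasurableSet {y | DifferentiableAt ℝ g y} := measurableSet_of_differentiableAt ℝ g
  have hD0 : (volume : Measure (ℝ ∙ ν)ᗮ) {y | DifferentiableAt ℝ g y}ᶜ = 0 :=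
    hg.ae_differentiableAt
  have hD1 : (μHE[m].comap (graphMap ν g)) {y | DifferentiableAt ℝ g y}ᶜ = 0 := by
    rw [hemb.comap_apply]
    have h := euclideanHausdorffMeasure_image_le_of_dist_le m (a := graphMap ν g) (b := id)
      (s := {y | DifferentiableAt ℝ g y}ᶜ) (fun x _ y _ =>
        (lipschitzWith_graphMap hg).dist_le_mul x y)
    rw [image_id, InnerProductSpace.euclideanHausdorffMeasure_eq_volume, hD0, mul_zero] at h
    exact le_antisymm h zero_le
  have hmain : ∀ s, MeasurableSet s → (∀ y ∈ s, DifferentiableAt ℝ g y) →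
      (μHE[m].comap (graphMap ν g)) s =
        (volume.withDensity fun y => ENNReal.ofReal (graphDensity g y)) s := by
    intro s hs hd
    have hev : ∀ᶠ δ : ℝ≥0 in 𝓝[>] 0, 0 < δ ∧ δ < 1 :=
      Filter.Eventually.and self_mem_nhdsWithin (mem_nhdsWithin_of_mem_nhds (gt_mem_nhds zero_lt_one))
    refine le_antisymm ?_ ?_
    · have hlim : Tendsto (fun δ : ℝ≥0 => (((1 + δ) ^ (m + 1) : ℝ≥0) : ℝ≥0∞) *
          (volume.withDensity fun y => ENNReal.ofReal (graphDensity g y)) s) (𝓝[>] 0)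
          (𝓝 (1 * (volume.withDensity fun y => ENNReal.ofReal (graphDensity g y)) s)) := by
        refine ENNReal.Tendsto.mul_const ?_ (Or.inl one_ne_zero)
        have hc : Continuous fun δ : ℝ≥0 => (1 + δ) ^ (m + 1) := by fun_prop
        have := (hc.tendsto 0).mono_left (nhdsWithin_le_nhds (s := Ioi 0))
        rw [← ENNReal.coe_one]
        exact ENNReal.tendsto_coe.2 (by simpa using this)
      rw [one_mul] at hlim
      refine ge_of_tendsto hlim ?_
      filter_upwards [hev] with δ hδ using (comap_graphMap_comparable hν hg hδ.1 hδ.2 hs hd).1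
    · have hlim : Tendsto (fun δ : ℝ≥0 => (((1 - δ)⁻¹ ^ m * (1 + δ) : ℝ≥0) : ℝ≥0∞) *
          (μHE[m].comap (graphMap ν g)) s) (𝓝[>] 0)
          (𝓝 (1 * (μHE[m].comap (graphMap ν g)) s)) := by
        refine ENNReal.Tendsto.mul_const ?_ (Or.inl one_ne_zero)
        have hc : ContinuousAt (fun δ : ℝ≥0 => (1 - δ)⁻¹ ^ m * (1 + δ)) 0 := by
          have : ContinuousAt (fun δ : ℝ≥0 => (1 - δ)⁻¹) 0 :=
            ContinuousAt.inv₀ (by fun_prop) (by simp)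
          fun_prop
        have := hc.tendsto.mono_left (nhdsWithin_le_nhds (s := Ioi 0))
        rw [← ENNReal.coe_one]
        exact ENNReal.tendsto_coe.2 (by simpa using this)
      rw [one_mul] at hlim
      refine ge_of_tendsto hlim ?_
      filter_upwards [hev] with δ hδ using (comap_graphMap_comparable hν hg hδ.1 hδ.2 hs hd).2
  ext s hs
  rw [← measure_inter_add_sdiff s hDm, ← measure_inter_add_sdiff (μ := volume.withDensity _) s hDm,
    hmain _ (hs.inter hDm) fun y hy => hy.2,
    measure_mono_null (sdiff_subset_compl _ _) hD1,
    measure_mono_null (sdiff_subset_compl _ _) (withDensity_absolutelyContinuous _ _ hD0)]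

/-- Integration over a Lipschitz graph in the coordinates of the base. No integrability or
measurability is needed, the parametrization being a measurable embedding. -/
theorem integral_range_graphMap (hν : ‖ν‖ = 1) (hg : LipschitzWith K g) (f : E → ℝ) :
    ∫ x in range (graphMap ν g), f x ∂μHE[Module.finrank ℝ (ℝ ∙ ν)ᗮ] =
      ∫ y, graphDensity g y * f (graphMap ν g y) := by
  have hemb := measurableEmbedding_graphMap (ν := ν) hg
  rw [← hemb.map_comap, hemb.integral_map, comap_graphMap_euclideanHausdorffMeasure hν hg,
    integral_withDensity_eq_integral_toReal_smul
      (measurable_graphDensity g).ennreal_ofReal (ae_of_all _ fun _ => ENNReal.ofReal_lt_top)]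
  refine integral_congr_ae (ae_of_all _ fun y => ?_)
  dsimp only
  rw [ENNReal.toReal_ofReal (zero_le_one.trans (one_le_graphDensity g y)), smul_eq_mul]

end AreaFormula

/-! ### Coordinates adapted to a graph -/

section GraphCoordinates

variable {E : Type*} [NormedAddCommGroup E] [InnerProductSpace ℝ E] {ν : E}

theorem coe_orthogonalProjectionOnto_orthogonal (hν : ‖ν‖ = 1) (x : E) :
    ((ℝ ∙ ν)ᗮ.orthogonalProjectionOnto x : E) = x - ⟪ν, x⟫ • ν := by
  have h := (ℝ ∙ ν).starProjection_add_starProjection_orthogonal x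
  rw [Submodule.starProjection_unit_singleton ℝ hν] at h
  exact eq_sub_of_add_eq' h

/-- The height of `x` above the graph of `g`, in the direction `ν`. -/
noncomputable def graphHeight (ν : E) (g : (ℝ ∙ ν)ᗮ → ℝ) (x : E) : ℝ :=
  ⟪ν, x⟫ - g ((ℝ ∙ ν)ᗮ.orthogonalProjectionOnto x)

theorem orthogonalProjectionOnto_graphMap_add (hν : ‖ν‖ = 1) (g : (ℝ ∙ ν)ᗮ → ℝ) (y : (ℝ ∙ ν)ᗮ)
    (t : ℝ) : (ℝ ∙ ν)ᗮ.orthogonalProjectionOnto (graphMap ν g y + t • ν) = y := by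
  refine Subtype.ext ?_
  rw [coe_orthogonalProjectionOnto_orthogonal hν]
  simp [graphMap, inner_add_right, inner_smul_right, inner_normal_coe_orthogonal, hν, add_smul]

theorem graphHeight_graphMap_add (hν : ‖ν‖ = 1) (g : (ℝ ∙ ν)ᗮ → ℝ) (y : (ℝ ∙ ν)ᗮ) (t : ℝ) :
    graphHeight ν g (graphMap ν g y + t • ν) = t := by
  rw [graphHeight, orthogonalProjectionOnto_graphMap_add hν]
  simp [graphMap, inner_add_right, inner_smul_right, inner_normal_coe_orthogonal, hν]

theorem graphMap_add_graphHeight (hν : ‖ν‖ = 1) (g : (ℝ ∙ ν)ᗮ → ℝ) (x : E) :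
    graphMap ν g ((ℝ ∙ ν)ᗮ.orthogonalProjectionOnto x) + graphHeight ν g x • ν = x := by
  rw [graphMap, graphHeight, coe_orthogonalProjectionOnto_orthogonal hν, sub_smul]
  abel

theorem lipschitzWith_graphHeight (hν : ‖ν‖ = 1) {K : ℝ≥0} {g : (ℝ ∙ ν)ᗮ → ℝ}
    (hg : LipschitzWith K g) : LipschitzWith (1 + K) (graphHeight ν g) := by
  refine LipschitzWith.of_dist_le_mul fun x z => ?_
  have h1 : |⟪ν, x - z⟫| ≤ ‖x - z‖ := by
    simpa [hν] using abs_real_inner_le_norm ν (x - z)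
  have h2 := hg.dist_le_mul ((ℝ ∙ ν)ᗮ.orthogonalProjectionOnto x)
    ((ℝ ∙ ν)ᗮ.orthogonalProjectionOnto z)
  have h3 : dist ((ℝ ∙ ν)ᗮ.orthogonalProjectionOnto x) ((ℝ ∙ ν)ᗮ.orthogonalProjectionOnto z) ≤
      ‖x - z‖ := by
    rw [dist_eq_norm, ← map_sub]
    exact (ℝ ∙ ν)ᗮ.norm_orthogonalProjectionOnto_apply_le _
  have h4 : graphHeight ν g x - graphHeight ν g z = ⟪ν, x - z⟫ -
      (g ((ℝ ∙ ν)ᗮ.orthogonalProjectionOnto x) - g ((ℝ ∙ ν)ᗮ.orthogonalProjectionOnto z)) := by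
    rw [inner_sub_right, graphHeight, graphHeight]
    ring
  rw [Real.dist_eq, h4, dist_eq_norm, NNReal.coe_add, NNReal.coe_one]
  rw [Real.dist_eq] at h2
  have h5 := abs_sub ⟪ν, x - z⟫
    (g ((ℝ ∙ ν)ᗮ.orthogonalProjectionOnto x) - g ((ℝ ∙ ν)ᗮ.orthogonalProjectionOnto z))
  nlinarith [K.coe_nonneg]

theorem continuous_graphMap_add {g : (ℝ ∙ ν)ᗮ → ℝ} (hg : Continuous g) (ε : ℝ) :
    Continuous fun p : (ℝ ∙ ν)ᗮ × ℝ => graphMap ν g p.1 + (ε * p.2) • ν := by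
  unfold graphMap
  fun_prop

variable [FiniteDimensional ℝ E]

/-- The gradient `ν - ∇g` of the height above the graph of `g`; it is orthogonal to the graph, and
points to its upper side. -/
noncomputable def graphNormal (g : (ℝ ∙ ν)ᗮ → ℝ) (y : (ℝ ∙ ν)ᗮ) : E :=
  ν - (∇ g y : (ℝ ∙ ν)ᗮ)

theorem inner_graphNormal (g : (ℝ ∙ ν)ᗮ → ℝ) (y : (ℝ ∙ ν)ᗮ) (v : E) :
    ⟪graphNormal g y, v⟫ = ⟪ν, v⟫ - fderiv ℝ g y ((ℝ ∙ ν)ᗮ.orthogonalProjectionOnto v) := by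
  rw [graphNormal, inner_sub_left, ← Submodule.inner_orthogonalProjectionOnto_eq_of_mem_left,
    gradient, InnerProductSpace.toDual_symm_apply]

theorem norm_graphNormal (hν : ‖ν‖ = 1) (g : (ℝ ∙ ν)ᗮ → ℝ) (y : (ℝ ∙ ν)ᗮ) :
    ‖graphNormal g y‖ = graphDensity g y := by
  have h : ‖graphNormal g y‖ ^ 2 = 1 + ‖fderiv ℝ g y‖ ^ 2 := by
    rw [graphNormal, norm_sub_sq_real, inner_normal_coe_orthogonal, hν, ← Submodule.coe_norm,
      gradient, LinearIsometryEquiv.norm_map]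
    ring
  rw [graphDensity, ← h, Real.sqrt_sq (norm_nonneg _)]

theorem norm_graphNormal_le (hν : ‖ν‖ = 1) {K : ℝ≥0} {g : (ℝ ∙ ν)ᗮ → ℝ} (hg : LipschitzWith K g)
    (y : (ℝ ∙ ν)ᗮ) : ‖graphNormal g y‖ ≤ 1 + K := by
  refine (norm_sub_le _ _).trans ?_
  rw [hν, ← Submodule.coe_norm, gradient, LinearIsometryEquiv.norm_map]
  gcongr
  exact norm_fderiv_le_of_lipschitz ℝ hg

theorem hasFDerivAt_graphHeight {g : (ℝ ∙ ν)ᗮ → ℝ} {x : E}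
    (h : DifferentiableAt ℝ g ((ℝ ∙ ν)ᗮ.orthogonalProjectionOnto x)) :
    HasFDerivAt (graphHeight ν g)
      (innerSL ℝ (graphNormal g ((ℝ ∙ ν)ᗮ.orthogonalProjectionOnto x))) x := by
  have h1 := (innerSL ℝ ν).hasFDerivAt.sub
    (h.hasFDerivAt.comp x ((ℝ ∙ ν)ᗮ.orthogonalProjectionOnto).hasFDerivAt)
  refine h1.congr_fderiv ?_
  ext v
  simp [inner_graphNormal]

variable [MeasurableSpace E] [BorelSpace E]

theorem measurable_graphNormal (g : (ℝ ∙ ν)ᗮ → ℝ) : Measurable (graphNormal g) := by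
  have h : Measurable (fun y => (∇ g y : (ℝ ∙ ν)ᗮ)) :=
    (InnerProductSpace.toDual ℝ (ℝ ∙ ν)ᗮ).symm.continuous.measurable.comp (measurable_fderiv ℝ g)
  exact measurable_const.sub (measurable_subtype_coe.comp h)

/-- Cartesian coordinates along and across a hyperplane. -/
theorem measurePreserving_coe_add_smul (hν : ‖ν‖ = 1) :
    MeasurePreserving (fun p : (ℝ ∙ ν)ᗮ × ℝ => (p.1 : E) + p.2 • ν) := by
  have h1 := ((ℝ ∙ ν).measurePreserving_measurableEquivProd (0 : E)).symm
  rw [InnerProductSpace.euclideanHausdorffMeasure_eq_volume] at h1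
  have h2 := (LinearIsometryEquiv.toSpanUnitSingleton (𝕜 := ℝ) ν hν).measurePreserving
  have h3 := h2.prod (MeasurePreserving.id (volume : Measure (ℝ ∙ ν)ᗮ))
  have h4 := h1.comp (h3.comp (Measure.measurePreserving_swap (μ := (volume : Measure (ℝ ∙ ν)ᗮ))
    (ν := (volume : Measure ℝ))))
  convert! h4 using 1
  ext p
  simp [add_comm]

/-- Change of variables to the height above a graph, scaled by `ε`. -/
theorem integral_eq_mul_integral_graphMap_add (hν : ‖ν‖ = 1) {g : (ℝ ∙ ν)ᗮ → ℝ}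
    (hg : Continuous g) {ε : ℝ} (hε : 0 < ε) (G : E → ℝ) :
    ∫ x, G x = ε * ∫ p : (ℝ ∙ ν)ᗮ × ℝ, G (graphMap ν g p.1 + (ε * p.2) • ν) := by
  have hT := measurePreserving_coe_add_smul hν
  have hTe : MeasurableEmbedding (fun p : (ℝ ∙ ν)ᗮ × ℝ => (p.1 : E) + p.2 • ν) := by
    refine Continuous.measurableEmbedding (by fun_prop) ?_
    rintro ⟨y, s⟩ ⟨z, t⟩ h
    have h1 := norm_le_norm_coe_add_smul (y - z) (s - t)
    have h2 : ((y - z : (ℝ ∙ ν)ᗮ) : E) + (s - t) • ν = 0 := by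
      rw [← sub_eq_zero.2 h]
      simp only [Submodule.coe_sub, sub_smul]
      abel
    rw [h2, norm_zero] at h1
    have hyz : y = z := sub_eq_zero.1 (norm_le_zero_iff.1 h1)
    subst hyz
    have hν0 : ν ≠ 0 := norm_ne_zero_iff.1 (by rw [hν]; exact one_ne_zero)
    simp only [add_right_inj] at h
    rw [smul_left_injective ℝ hν0 h]
  have hS : MeasurePreserving (fun p : (ℝ ∙ ν)ᗮ × ℝ => (p.1, g p.1 + ε * p.2))
      (volume.prod volume) (volume.prod (ENNReal.ofReal ε⁻¹ • volume)) := by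
    refine (MeasurePreserving.id _).skew_product (g := fun y t => g y + ε * t) (by fun_prop)
      (ae_of_all _ fun y => ?_)
    have h1 : (fun t => g y + ε * t) = (fun t => g y + t) ∘ fun t => ε * t := rfl
    rw [h1, ← Measure.map_map (by fun_prop) (by fun_prop), Real.map_volume_mul_left hε.ne',
      Measure.map_smul, map_add_left_eq_self, abs_of_pos (inv_pos.2 hε)]
  have hSe : MeasurableEmbedding (fun p : (ℝ ∙ ν)ᗮ × ℝ => (p.1, g p.1 + ε * p.2)) := by
    refine Continuous.measurableEmbedding (by fun_prop) ?_
    rintro ⟨y, s⟩ ⟨z, t⟩ h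
    simp only [Prod.mk.injEq] at h
    obtain ⟨rfl, h⟩ := h
    have : s = t := mul_left_cancel₀ hε.ne' (add_left_cancel h)
    rw [this]
  have h1 := hS.integral_comp hSe fun p : (ℝ ∙ ν)ᗮ × ℝ => G ((p.1 : E) + p.2 • ν)
  rw [Measure.prod_smul_right, integral_smul_measure, ← Measure.volume_eq_prod,
    hT.integral_comp hTe, ENNReal.toReal_ofReal (inv_pos.2 hε).le] at h1
  simp only [graphMap, add_assoc, ← add_smul]
  rw [h1, smul_eq_mul, mul_inv_cancel_left₀ hε.ne']

theorem ae_differentiableAt_orthogonalProjectionOnto {K : ℝ≥0}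
    {g : (ℝ ∙ ν)ᗮ → ℝ} (hg : LipschitzWith K g) :
    ∀ᵐ x : E, DifferentiableAt ℝ g ((ℝ ∙ ν)ᗮ.orthogonalProjectionOnto x) := by
  have h1 := (ℝ ∙ ν).measurePreserving_measurableEquivProd (0 : E)
  rw [InnerProductSpace.euclideanHausdorffMeasure_eq_volume, Measure.volume_eq_prod] at h1
  have h2 := (Measure.quasiMeasurePreserving_snd (μ := (volume : Measure (ℝ ∙ ν)))
    (ν := (volume : Measure (ℝ ∙ ν)ᗮ))).comp h1.quasiMeasurePreserving
  have h3 := h2.ae (p := fun y => DifferentiableAt ℝ g y) hg.ae_differentiableAt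
  simpa using h3

end GraphCoordinates

/-! ### A smooth step -/

/-- A smooth step, `0` on `(-∞, 1]` and `1` on `[2, ∞)`. -/
noncomputable def smoothStep (t : ℝ) : ℝ := Real.smoothTransition (t - 1)

theorem contDiff_smoothStep : ContDiff ℝ 1 smoothStep :=
  (Real.smoothTransition.contDiff (n := 1)).comp (contDiff_id.sub contDiff_const)

theorem differentiable_smoothStep : Differentiable ℝ smoothStep :=
  contDiff_smoothStep.differentiable one_ne_zero

theorem continuous_deriv_smoothStep : Continuous (deriv smoothStep) :=
  contDiff_smoothStep.continuous_deriv le_rfl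

theorem smoothStep_of_le_one {t : ℝ} (h : t ≤ 1) : smoothStep t = 0 :=
  Real.smoothTransition.zero_of_nonpos (by linarith)

theorem smoothStep_of_two_le {t : ℝ} (h : 2 ≤ t) : smoothStep t = 1 :=
  Real.smoothTransition.one_of_one_le (by linarith)

theorem abs_smoothStep_le (t : ℝ) : |smoothStep t| ≤ 1 :=
  abs_le.2 ⟨neg_one_lt_zero.le.trans (Real.smoothTransition.nonneg _),
    Real.smoothTransition.le_one _⟩

theorem deriv_smoothStep_eq_zero {t : ℝ} (h : t ∉ Icc (1 : ℝ) 2) : deriv smoothStep t = 0 := by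
  rcases not_and_or.1 h with h | h
  · have : smoothStep =ᶠ[𝓝 t] fun _ => 0 := by
      filter_upwards [gt_mem_nhds (not_le.1 h)] with s hs using smoothStep_of_le_one (le_of_lt hs)
    simp [this.deriv_eq]
  · have : smoothStep =ᶠ[𝓝 t] fun _ => 1 := by
      filter_upwards [lt_mem_nhds (not_le.1 h)] with s hs using smoothStep_of_two_le (le_of_lt hs)
    simp [this.deriv_eq]

theorem hasCompactSupport_deriv_smoothStep : HasCompactSupport (deriv smoothStep) :=
  HasCompactSupport.intro isCompact_Icc fun _ h => deriv_smoothStep_eq_zero h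

theorem exists_bound_deriv_smoothStep : ∃ D : ℝ≥0, ∀ t, ‖deriv smoothStep t‖ ≤ D := by
  obtain ⟨D, hD⟩ := hasCompactSupport_deriv_smoothStep.exists_bound_of_continuous
    continuous_deriv_smoothStep
  exact ⟨⟨D, (norm_nonneg _).trans (hD 0)⟩, hD⟩

theorem integral_deriv_smoothStep : ∫ t, deriv smoothStep t = 1 := by
  have h := integral_of_hasDerivAt_of_tendsto (f := smoothStep) (m := 0) (n := 1)
    (fun t => (differentiable_smoothStep t).hasDerivAt)
    (continuous_deriv_smoothStep.integrable_of_hasCompactSupport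
      hasCompactSupport_deriv_smoothStep)
    (tendsto_const_nhds.congr' ?_) (tendsto_const_nhds.congr' ?_)
  · simpa using h
  · filter_upwards [eventually_le_atBot (1 : ℝ)] with t ht using (smoothStep_of_le_one ht).symm
  · filter_upwards [eventually_ge_atTop (2 : ℝ)] with t ht using (smoothStep_of_two_le ht).symm

/-! ### The divergence theorem near a Lipschitz graph -/

section LocalDivergence

variable {d : ℕ} {X : Set (EuclideanSpace ℝ (Fin d))}
  {F : EuclideanSpace ℝ (Fin d) → EuclideanSpace ℝ (Fin d)}
  {φ : EuclideanSpace ℝ (Fin d) → ℝ} {ν : EuclideanSpace ℝ (Fin d)} {K : ℝ≥0}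
  {g : (ℝ ∙ ν)ᗮ → ℝ} {U : Set (EuclideanSpace ℝ (Fin d))}

theorem lipschitzWith_mul_smoothStep {E : Type*} [PseudoMetricSpace E] {φ h : E → ℝ}
    {C C' D : ℝ≥0} {M : ℝ} (hφ : LipschitzWith C φ) (hM : ∀ x, ‖φ x‖ ≤ M)
    (hD : ∀ t, ‖deriv smoothStep t‖ ≤ D) (hh : LipschitzWith C' h) {ε : ℝ} (hε : 0 < ε) :
    ∃ C'', LipschitzWith C'' fun x => φ x * smoothStep (h x / ε) := by
  have hs : LipschitzWith D smoothStep :=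
    lipschitzWith_of_nnnorm_deriv_le differentiable_smoothStep fun t => hD t
  refine ⟨Real.toNNReal (C + M * (D * (C' / ε))), LipschitzWith.of_dist_le' fun x y => ?_⟩
  have h1 : |smoothStep (h x / ε) - smoothStep (h y / ε)| ≤ D * (C' / ε) * dist x y := by
    have h2 := hs.dist_le_mul (h x / ε) (h y / ε)
    have h3 := hh.dist_le_mul x y
    rw [Real.dist_eq, Real.dist_eq, ← sub_div, abs_div, abs_of_pos hε] at h2
    rw [Real.dist_eq] at h3
    refine h2.trans ?_
    rw [mul_assoc, div_mul_eq_mul_div]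
    gcongr
  have h4 := hφ.dist_le_mul x y
  have h5 : φ x * smoothStep (h x / ε) - φ y * smoothStep (h y / ε) =
      φ x * (smoothStep (h x / ε) - smoothStep (h y / ε)) +
        (φ x - φ y) * smoothStep (h y / ε) := by ring
  rw [Real.dist_eq] at h4 ⊢
  rw [h5]
  refine (abs_add_le _ _).trans ?_
  rw [abs_mul, abs_mul]
  have h6 : |φ x| * |smoothStep (h x / ε) - smoothStep (h y / ε)| ≤
      M * (D * (C' / ε) * dist x y) :=
    mul_le_mul (hM x) h1 (abs_nonneg _) ((norm_nonneg _).trans (hM x))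
  have h7 : |φ x - φ y| * |smoothStep (h y / ε)| ≤ C * dist x y * 1 :=
    mul_le_mul h4 (abs_smoothStep_le _) (abs_nonneg _) (by positivity)
  linarith

/-- The contribution of the thin layer above the graph, in which the smooth step is not constant,
tends to the flux through the graph. -/
theorem tendsto_integral_layer (hν : ‖ν‖ = 1) (hX : IsOpen X) (hF : ContinuousOn F (closure X))
    (hg : LipschitzWith K g) (hU : IsOpen U) (hUX : ∀ x ∈ U, x ∈ X ↔ 0 < graphHeight ν g x)
    (hφ : Continuous φ) (hc : HasCompactSupport φ) (hsub : tsupport φ ⊆ U) :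
    Tendsto (fun ε : ℝ => ∫ x in X, φ x * (deriv smoothStep (graphHeight ν g x / ε) / ε *
        ⟪graphNormal g ((ℝ ∙ ν)ᗮ.orthogonalProjectionOnto x), F x⟫)) (𝓝[>] 0)
      (𝓝 (∫ y, φ (graphMap ν g y) * ⟪graphNormal g y, F (graphMap ν g y)⟫)) := by
  obtain ⟨D, hD⟩ := exists_bound_deriv_smoothStep
  obtain ⟨M₁, hM₁⟩ := hc.exists_bound_of_continuous hφ
  obtain ⟨M₂, hM₂0, hM₂⟩ : ∃ M₂, 0 ≤ M₂ ∧ ∀ x ∈ tsupport φ ∩ closure X, ‖F x‖ ≤ M₂ := by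
    obtain ⟨M, hM⟩ := (hc.isCompact.inter_right isClosed_closure).exists_bound_of_continuousOn
      (hF.mono inter_subset_right)
    exact ⟨max M 0, le_max_right _ _, fun x hx => (hM x hx).trans (le_max_left _ _)⟩
  obtain ⟨R, hR⟩ := hc.isCompact.isBounded.subset_closedBall (0 : EuclideanSpace ℝ (Fin d))
  have hM₁0 : 0 ≤ M₁ := (norm_nonneg _).trans (hM₁ 0)
  set F₁ := X.indicator F with hF₁
  have hF₁m : Measurable F₁ := by
    classical
    have h := (hF.mono subset_closure).measurable_piecewise (g := 0) continuousOn_const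
      hX.measurableSet
    rwa [piecewise_eq_indicator] at h
  let pt : ℝ → (ℝ ∙ ν)ᗮ × ℝ → EuclideanSpace ℝ (Fin d) := fun ε p =>
    graphMap ν g p.1 + (ε * p.2) • ν
  have hptc : ∀ ε, Continuous (pt ε) := continuous_graphMap_add hg.continuous
  have hptε : ∀ p, Continuous fun ε => pt ε p := fun p => by
    simp only [pt]
    fun_prop
  have hpt0 : ∀ p, pt 0 p = graphMap ν g p.1 := fun p => by simp [pt]
  let J : ℝ → (ℝ ∙ ν)ᗮ × ℝ → ℝ := fun ε p =>
    φ (pt ε p) * ⟪graphNormal g p.1, F₁ (pt ε p)⟫ * deriv smoothStep p.2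
  have hJ : ∀ ε, 0 < ε → ∫ p, J ε p =
      ∫ x in X, φ x * (deriv smoothStep (graphHeight ν g x / ε) / ε *
        ⟪graphNormal g ((ℝ ∙ ν)ᗮ.orthogonalProjectionOnto x), F x⟫) := by
    intro ε hε
    have h1 : ∫ x in X, φ x * (deriv smoothStep (graphHeight ν g x / ε) / ε *
          ⟪graphNormal g ((ℝ ∙ ν)ᗮ.orthogonalProjectionOnto x), F x⟫) =
        ∫ x in X, φ x * (deriv smoothStep (graphHeight ν g x / ε) / ε *
          ⟪graphNormal g ((ℝ ∙ ν)ᗮ.orthogonalProjectionOnto x), F₁ x⟫) :=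
      setIntegral_congr_fun hX.measurableSet fun x hx => by simp [F₁, hx]
    rw [h1, setIntegral_eq_integral_of_forall_compl_eq_zero fun x hx => by simp [F₁, hx],
      integral_eq_mul_integral_graphMap_add hν hg.continuous hε, ← integral_const_mul]
    refine integral_congr_ae (ae_of_all _ fun p => ?_)
    dsimp only
    rw [graphHeight_graphMap_add hν, orthogonalProjectionOnto_graphMap_add hν,
      mul_div_cancel_left₀ _ hε.ne']
    simp only [J, pt]
    field_simp
  have hlimit : ∫ p : (ℝ ∙ ν)ᗮ × ℝ, φ (graphMap ν g p.1) *
        ⟪graphNormal g p.1, F (graphMap ν g p.1)⟫ * deriv smoothStep p.2 =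
      ∫ y, φ (graphMap ν g y) * ⟪graphNormal g y, F (graphMap ν g y)⟫ := by
    rw [Measure.volume_eq_prod, integral_prod_mul (fun y : (ℝ ∙ ν)ᗮ => φ (graphMap ν g y) *
        ⟪graphNormal g y, F (graphMap ν g y)⟫), integral_deriv_smoothStep, mul_one]
  rw [← hlimit]
  have hbound : ∀ ε p, ‖J ε p‖ ≤
      ((Metric.closedBall (0 : (ℝ ∙ ν)ᗮ) R) ×ˢ Icc (1 : ℝ) 2).indicator
        (fun _ => M₁ * ((1 + K) * M₂) * D) p := by
    rintro ε p
    by_cases hp : p ∈ (Metric.closedBall (0 : (ℝ ∙ ν)ᗮ) R) ×ˢ Icc (1 : ℝ) 2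
    · rw [indicator_of_mem hp]
      by_cases hx : pt ε p ∈ tsupport φ ∩ X
      · have hM₂' : ‖F₁ (pt ε p)‖ ≤ M₂ := by
          rw [hF₁, indicator_of_mem hx.2]
          exact hM₂ _ ⟨hx.1, subset_closure hx.2⟩
        have h1 : ‖⟪graphNormal g p.1, F₁ (pt ε p)⟫‖ ≤ (1 + K) * M₂ :=
          (norm_inner_le_norm _ _).trans (mul_le_mul (norm_graphNormal_le hν hg _) hM₂'
            (norm_nonneg _) (by positivity))
        rw [norm_mul, norm_mul]
        have := (norm_nonneg _).trans h1
        gcongr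
        · exact hM₁ _
        · exact hD _
      · have h0 : J ε p = 0 := by
          rcases not_and_or.1 hx with h | h
          · simp [J, image_eq_zero_of_notMem_tsupport h]
          · simp [J, F₁, h]
        rw [h0, norm_zero]
        positivity
    · rw [indicator_of_notMem hp]
      refine (norm_eq_zero.2 ?_).le
      rcases not_and_or.1 (fun h => hp (mem_prod.2 h)) with h | h
      · have : pt ε p ∉ tsupport φ := fun hmem => h <| by
          have h1 := mem_closedBall_zero_iff.1 (hR hmem)
          rw [mem_closedBall_zero_iff]
          refine le_trans ?_ h1
          simp only [pt, graphMap, add_assoc, ← add_smul]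
          exact norm_le_norm_coe_add_smul _ _
        simp [J, image_eq_zero_of_notMem_tsupport this]
      · simp [J, deriv_smoothStep_eq_zero h]
  have hmain : Tendsto (fun ε => ∫ p, J ε p) (𝓝[>] 0)
      (𝓝 (∫ p : (ℝ ∙ ν)ᗮ × ℝ, φ (graphMap ν g p.1) *
        ⟪graphNormal g p.1, F (graphMap ν g p.1)⟫ * deriv smoothStep p.2)) := by
    refine tendsto_integral_filter_of_dominated_convergence _ (Eventually.of_forall fun ε => ?_)
      (Eventually.of_forall fun ε => ae_of_all _ (hbound ε)) ?_ (ae_of_all _ fun p => ?_)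
    · have h1 : Measurable fun p => φ (pt ε p) := (hφ.comp (hptc ε)).measurable
      have h2 : Measurable fun p : (ℝ ∙ ν)ᗮ × ℝ => graphNormal g p.1 :=
        (measurable_graphNormal g).comp measurable_fst
      have h3 : Measurable fun p => F₁ (pt ε p) := hF₁m.comp (hptc ε).measurable
      have h4 : Measurable fun p : (ℝ ∙ ν)ᗮ × ℝ => deriv smoothStep p.2 :=
        continuous_deriv_smoothStep.measurable.comp measurable_snd
      exact ((h1.mul (h2.inner h3)).mul h4).aestronglyMeasurable
    · have hcomp : IsCompact ((Metric.closedBall (0 : (ℝ ∙ ν)ᗮ) R) ×ˢ Icc (1 : ℝ) 2) :=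
        (isCompact_closedBall _ _).prod isCompact_Icc
      exact (integrableOn_const (hs := hcomp.measure_lt_top.ne)).integrable_indicator
        hcomp.measurableSet
    · by_cases hp : p.2 ∈ Icc (1 : ℝ) 2
      swap
      · simp only [J, deriv_smoothStep_eq_zero hp, mul_zero]
        exact tendsto_const_nhds
      refine Tendsto.mul_const _ ?_
      have hpt : Tendsto (fun ε => pt ε p) (𝓝[>] 0) (𝓝 (graphMap ν g p.1)) := by
        rw [← hpt0 p]
        exact ((hptε p).tendsto 0).mono_left nhdsWithin_le_nhds
      by_cases hy : graphMap ν g p.1 ∈ tsupport φ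
      · -- the points at positive height lie in `X`, up to whose boundary `F` is continuous
        have hin : ∀ᶠ ε in 𝓝[>] (0 : ℝ), pt ε p ∈ X := by
          filter_upwards [hpt.eventually (hU.mem_nhds (hsub hy)), self_mem_nhdsWithin] with ε h1 h2
          rw [hUX _ h1, graphHeight_graphMap_add hν]
          exact mul_pos h2 (zero_lt_one.trans_le hp.1)
        have hcl : graphMap ν g p.1 ∈ closure X := mem_closure_of_tendsto hpt hin
        have hFt : Tendsto (fun ε => F₁ (pt ε p)) (𝓝[>] 0) (𝓝 (F (graphMap ν g p.1))) := by
          have h1 : Tendsto (fun ε => F (pt ε p)) (𝓝[>] 0) (𝓝 (F (graphMap ν g p.1))) :=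
            (hF _ hcl).tendsto.comp (tendsto_nhdsWithin_iff.2
              ⟨hpt, hin.mono fun ε h => subset_closure h⟩)
          exact h1.congr' (hin.mono fun ε h => (indicator_of_mem h F).symm)
        exact ((hφ.tendsto _).comp hpt).mul (tendsto_const_nhds.inner hFt)
      · rw [image_eq_zero_of_notMem_tsupport hy, zero_mul]
        refine tendsto_const_nhds.congr' ?_
        filter_upwards [hpt.eventually ((isClosed_tsupport φ).isOpen_compl.mem_nhds hy)] with ε h
        rw [image_eq_zero_of_notMem_tsupport h, zero_mul]
  refine hmain.congr' ?_
  filter_upwards [self_mem_nhdsWithin] with ε hε using hJ ε hε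

/-- The divergence theorem for a test function supported where `X` is the region above a Lipschitz
graph, the flux being written in the coordinates of the base of the graph. -/
theorem integral_mul_divergence_add_fderiv_of_graph (hν : ‖ν‖ = 1) (hX : IsOpen X)
    (hF : ContinuousOn F (closure X)) (hFd : DifferentiableOn ℝ F X)
    (hdiv : IntegrableOn (divergence F) X) (hg : LipschitzWith K g) (hU : IsOpen U)
    (hUX : ∀ x ∈ U, x ∈ X ↔ 0 < graphHeight ν g x) (hφ : ContDiff ℝ 1 φ)
    (hc : HasCompactSupport φ) (hsub : tsupport φ ⊆ U) :
    ∫ x in X, (φ x * divergence F x + fderiv ℝ φ x (F x)) =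
      -∫ y, φ (graphMap ν g y) * ⟪graphNormal g y, F (graphMap ν g y)⟫ := by
  obtain ⟨C, hC⟩ := hφ.lipschitzWith_of_hasCompactSupport hc one_ne_zero
  obtain ⟨D, hD⟩ := exists_bound_deriv_smoothStep
  obtain ⟨M, hM⟩ := hc.exists_bound_of_continuous hφ.continuous
  have hh := lipschitzWith_graphHeight hν hg
  have hA : IntegrableOn (fun x => φ x * divergence F x + fderiv ℝ φ x (F x)) X :=
    (integrableOn_mul_divergence hdiv hφ.continuous hc).add
      (integrableOn_fderiv_apply hX hF hC hc)
  set A : EuclideanSpace ℝ (Fin d) → ℝ :=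
    fun x => φ x * divergence F x + fderiv ℝ φ x (F x) with hAdef
  have hstep : ∀ ε, Continuous fun x => smoothStep (graphHeight ν g x / ε) := fun ε =>
    contDiff_smoothStep.continuous.comp (hh.continuous.div_const ε)
  have hAε : ∀ ε, IntegrableOn (fun x => smoothStep (graphHeight ν g x / ε) * A x) X := fun ε =>
    Integrable.bdd_mul hA (hstep ε).aestronglyMeasurable (ae_of_all _ fun x => abs_smoothStep_le _)
  have hlim1 : Tendsto (fun ε : ℝ => ∫ x in X, smoothStep (graphHeight ν g x / ε) * A x) (𝓝[>] 0)
      (𝓝 (∫ x in X, A x)) := by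
    refine tendsto_integral_filter_of_dominated_convergence (fun x => ‖A x‖)
      (Eventually.of_forall fun ε => (hAε ε).aestronglyMeasurable)
      (Eventually.of_forall fun ε => ae_of_all _ fun x => ?_) hA.norm
      ((ae_restrict_iff' hX.measurableSet).2 (ae_of_all _ fun x hx => ?_))
    · rw [norm_mul]
      exact mul_le_of_le_one_left (norm_nonneg _) (abs_smoothStep_le _)
    · by_cases hxt : x ∈ tsupport φ
      · have hpos : 0 < graphHeight ν g x := (hUX x (hsub hxt)).1 hx
        refine tendsto_const_nhds.congr' ?_
        filter_upwards [mem_nhdsWithin_of_mem_nhds (gt_mem_nhds (half_pos hpos)),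
          self_mem_nhdsWithin] with ε h1 h2
        have h2' : (0 : ℝ) < ε := h2
        rw [smoothStep_of_two_le (by rw [le_div_iff₀ h2']; linarith), one_mul]
      · have h0 : A x = 0 := by
          rw [hAdef]
          simp [image_eq_zero_of_notMem_tsupport hxt,
            (notMem_tsupport_iff_eventuallyEq.1 hxt).fderiv_eq]
        simp only [h0, mul_zero]
        exact tendsto_const_nhds
  have hlim2 := tendsto_integral_layer hν hX hF hg hU hUX hφ.continuous hc hsub
  have hkey : ∀ ε : ℝ, 0 < ε → ∫ x in X, φ x * (deriv smoothStep (graphHeight ν g x / ε) / ε *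
        ⟪graphNormal g ((ℝ ∙ ν)ᗮ.orthogonalProjectionOnto x), F x⟫) =
      -∫ x in X, smoothStep (graphHeight ν g x / ε) * A x := by
    intro ε hε
    set ψ : EuclideanSpace ℝ (Fin d) → ℝ := fun x => φ x * smoothStep (graphHeight ν g x / ε)
      with hψ
    obtain ⟨C', hψL⟩ := lipschitzWith_mul_smoothStep hC hM hD hh hε
    have hψc : HasCompactSupport ψ := hc.mul_right
    -- the cut-off test function lives at height at least `ε`
    have hψsub : tsupport ψ ⊆ X := by
      have h1 : tsupport ψ ⊆ tsupport φ ∩ {x | ε ≤ graphHeight ν g x} := by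
        refine closure_minimal (fun x hx => ?_) ((isClosed_tsupport φ).inter
          (isClosed_le continuous_const hh.continuous))
        refine ⟨subset_tsupport _ (left_ne_zero_of_mul hx), ?_⟩
        by_contra hlt
        refine right_ne_zero_of_mul hx (smoothStep_of_le_one ?_)
        rw [div_le_one hε]
        exact (not_le.1 hlt).le
      intro x hx
      obtain ⟨h2, h3⟩ := h1 hx
      exact (hUX x (hsub h2)).2 (hε.trans_le h3)
    have h0 := integral_mul_divergence_add_fderiv_of_tsupport_subset hX hF hFd hdiv hψL hψc hψsub
    have hae : ∀ᵐ x ∂volume.restrict X, ψ x * divergence F x + fderiv ℝ ψ x (F x) =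
        smoothStep (graphHeight ν g x / ε) * A x +
          φ x * (deriv smoothStep (graphHeight ν g x / ε) / ε *
            ⟪graphNormal g ((ℝ ∙ ν)ᗮ.orthogonalProjectionOnto x), F x⟫) := by
      filter_upwards [ae_restrict_of_ae (ae_differentiableAt_orthogonalProjectionOnto hg)] with x hx
      have h1 := (hφ.differentiable one_ne_zero x).hasFDerivAt
      have h2 := (differentiable_smoothStep (graphHeight ν g x / ε)).hasDerivAt.comp_hasFDerivAt x
        ((hasFDerivAt_graphHeight hx).mul_const ε⁻¹)
      have h3 := (h1.mul h2).fderiv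
      have h4 : fderiv ℝ ψ x = _ := h3
      rw [h4]
      simp only [hψ, hAdef, Function.comp_apply, add_apply, smul_apply, innerSL_apply_apply, smul_eq_mul, div_eq_mul_inv]
      ring
    have hint : IntegrableOn (fun x => ψ x * divergence F x + fderiv ℝ ψ x (F x)) X :=
      (integrableOn_mul_divergence hdiv hψL.continuous hψc).add
        (integrableOn_fderiv_apply hX hF hψL hψc)
    have hB : IntegrableOn (fun x => φ x * (deriv smoothStep (graphHeight ν g x / ε) / ε *
        ⟪graphNormal g ((ℝ ∙ ν)ᗮ.orthogonalProjectionOnto x), F x⟫)) X := by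
      refine (hint.sub (hAε ε)).congr ?_
      filter_upwards [hae] with x hx
      simp only [Pi.sub_apply]
      rw [hx]
      ring
    rw [integral_congr_ae hae, integral_add (hAε ε) hB] at h0
    linarith
  have hlim3 := hlim1.neg.congr' (f₂ := fun ε : ℝ => ∫ x in X, φ x *
    (deriv smoothStep (graphHeight ν g x / ε) / ε *
      ⟪graphNormal g ((ℝ ∙ ν)ᗮ.orthogonalProjectionOnto x), F x⟫)) (by
    filter_upwards [self_mem_nhdsWithin] with ε hε using (hkey ε hε).symm)
  rw [tendsto_nhds_unique hlim2 hlim3, neg_neg]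

end LocalDivergence

/-! ### The boundary of a region above a Lipschitz graph -/

section GraphBoundary

variable {d : ℕ} {X : Set (EuclideanSpace ℝ (Fin d))}
  {F : EuclideanSpace ℝ (Fin d) → EuclideanSpace ℝ (Fin d)}
  {φ : EuclideanSpace ℝ (Fin d) → ℝ} {ν : EuclideanSpace ℝ (Fin d)} {K : ℝ≥0}
  {g : (ℝ ∙ ν)ᗮ → ℝ} {U : Set (EuclideanSpace ℝ (Fin d))}

theorem mem_frontier_iff_mem_range_graphMap (hν : ‖ν‖ = 1) (hX : IsOpen X)
    (hg : LipschitzWith K g) (hU : IsOpen U) (hUX : ∀ x ∈ U, x ∈ X ↔ 0 < graphHeight ν g x)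
    {x : EuclideanSpace ℝ (Fin d)} (hx : x ∈ U) :
    x ∈ frontier X ↔ x ∈ range (graphMap ν g) := by
  have hcont := (lipschitzWith_graphHeight hν hg).continuous
  rw [hX.frontier_eq]
  constructor
  · rintro ⟨hcl, hnot⟩
    have h0 : graphHeight ν g x = 0 := by
      refine le_antisymm (not_lt.1 fun h => hnot ((hUX x hx).2 h)) (not_lt.1 fun hneg => ?_)
      have hmem : U ∩ {z | graphHeight ν g z < 0} ∈ 𝓝 x :=
        inter_mem (hU.mem_nhds hx) ((isOpen_lt hcont continuous_const).mem_nhds hneg)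
      obtain ⟨z, ⟨hzU, hz⟩, hzX⟩ := mem_closure_iff_nhds.1 hcl _ hmem
      exact lt_asymm hz ((hUX z hzU).1 hzX)
    have := graphMap_add_graphHeight hν g x
    rw [h0, zero_smul, add_zero] at this
    exact ⟨_, this⟩
  · rintro ⟨y, rfl⟩
    have h0 := graphHeight_graphMap_add hν g y 0
    rw [zero_smul, add_zero] at h0
    refine ⟨?_, fun h => ((hUX _ hx).1 h).ne' h0⟩
    have ht : Tendsto (fun t : ℝ => graphMap ν g y + t • ν) (𝓝[>] 0) (𝓝 (graphMap ν g y)) := by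
      have : Continuous fun t : ℝ => graphMap ν g y + t • ν := by fun_prop
      simpa using (this.tendsto 0).mono_left nhdsWithin_le_nhds
    refine mem_closure_of_tendsto ht ?_
    filter_upwards [ht.eventually (hU.mem_nhds hx), self_mem_nhdsWithin] with t h1 h2
    rw [hUX _ h1, graphHeight_graphMap_add hν]
    exact h2

theorem isOutwardUnitNormal_graphMap (hν : ‖ν‖ = 1) (hU : IsOpen U)
    (hUX : ∀ x ∈ U, x ∈ X ↔ 0 < graphHeight ν g x) {y : (ℝ ∙ ν)ᗮ} (hy : graphMap ν g y ∈ U)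
    (hd : DifferentiableAt ℝ g y) :
    IsOutwardUnitNormal X (graphMap ν g y) (-(graphDensity g y)⁻¹ • graphNormal g y) := by
  have hJ : 0 < graphDensity g y := zero_lt_one.trans_le (one_le_graphDensity g y)
  have hP : (ℝ ∙ ν)ᗮ.orthogonalProjectionOnto (graphMap ν g y) = y := by
    simpa using orthogonalProjectionOnto_graphMap_add hν g y 0
  have h0 : graphHeight ν g (graphMap ν g y) = 0 := by
    simpa using graphHeight_graphMap_add hν g y 0
  constructor
  · rw [norm_smul, norm_graphNormal hν, norm_neg, norm_inv, Real.norm_of_nonneg hJ.le,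
      inv_mul_cancel₀ hJ.ne']
  · intro ε hε
    have hder := hasFDerivAt_graphHeight (ν := ν) (g := g) (x := graphMap ν g y) (by rwa [hP])
    rw [hP] at hder
    have hlo := hder.isLittleO.def (mul_pos hε hJ)
    filter_upwards [hlo, hU.mem_nhds hy] with z hz hzU
    rw [h0, sub_zero, innerSL_apply_apply, Real.norm_eq_abs, abs_le] at hz
    have hin : ⟪z - graphMap ν g y, -(graphDensity g y)⁻¹ • graphNormal g y⟫ =
        -((graphDensity g y)⁻¹ * ⟪graphNormal g y, z - graphMap ν g y⟫) := by
      rw [inner_smul_right, real_inner_comm, neg_mul]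
    have heq : ⟪graphNormal g y, z - graphMap ν g y⟫ = graphDensity g y *
        ((graphDensity g y)⁻¹ * ⟪graphNormal g y, z - graphMap ν g y⟫) := by
      rw [mul_inv_cancel_left₀ hJ.ne']
    rw [hin, hUX z hzU]
    set a := (graphDensity g y)⁻¹ * ⟪graphNormal g y, z - graphMap ν g y⟫
    rw [heq] at hz
    constructor
    · intro h
      nlinarith [hz.1, hz.2]
    · intro h h'
      nlinarith [hz.1, hz.2]

/-- The flux through the part of the boundary of `X` that is a Lipschitz graph: the density of the
surface measure cancels against the length of the normal. -/
theorem integral_surfaceMeasure_of_graph (hν : ‖ν‖ = 1) (hX : IsOpen X) (hg : LipschitzWith K g)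
    (hU : IsOpen U) (hUX : ∀ x ∈ U, x ∈ X ↔ 0 < graphHeight ν g x) (hsub : tsupport φ ⊆ U) :
    ∫ x, φ x * ⟪F x, outwardNormal X x⟫ ∂surfaceMeasure X =
      -∫ y, φ (graphMap ν g y) * ⟪graphNormal g y, F (graphMap ν g y)⟫ := by
  have hrank : Module.finrank ℝ (ℝ ∙ ν)ᗮ = d - 1 := by
    have hν0 : ν ≠ 0 := norm_ne_zero_iff.1 (by rw [hν]; exact one_ne_zero)
    have h := (ℝ ∙ ν).finrank_add_finrank_orthogonal
    rw [finrank_span_singleton hν0, finrank_euclideanSpace_fin] at h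
    omega
  have hind : (frontier X).indicator (fun x => φ x * ⟪F x, outwardNormal X x⟫) =
      (range (graphMap ν g)).indicator (fun x => φ x * ⟪F x, outwardNormal X x⟫) := by
    ext x
    by_cases hx : x ∈ U
    · have := mem_frontier_iff_mem_range_graphMap hν hX hg hU hUX hx
      by_cases h : x ∈ frontier X
      · rw [indicator_of_mem h, indicator_of_mem (this.1 h)]
      · rw [indicator_of_notMem h, indicator_of_notMem fun h' => h (this.2 h')]
    · have h0 : φ x = 0 := image_eq_zero_of_notMem_tsupport fun h => hx (hsub h)
      simp [indicator, h0]
  rw [surfaceMeasure, ← hrank, ← integral_indicator isClosed_frontier.measurableSet, hind,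
    integral_indicator (measurableEmbedding_graphMap hg).measurableSet_range,
    integral_range_graphMap hν hg, ← integral_neg]
  refine integral_congr_ae ?_
  filter_upwards [hg.ae_differentiableAt] with y hy
  by_cases hyU : graphMap ν g y ∈ U
  · have hn := isOutwardUnitNormal_graphMap hν hU hUX hyU hy
    have hex : ∃ n, IsOutwardUnitNormal X (graphMap ν g y) n := ⟨_, hn⟩
    have hJ : graphDensity g y ≠ 0 := (zero_lt_one.trans_le (one_le_graphDensity g y)).ne'
    rw [outwardNormal, dif_pos hex, hex.choose_spec.unique hn, inner_smul_right, real_inner_comm]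
    field_simp
  · have h0 : φ (graphMap ν g y) = 0 := image_eq_zero_of_notMem_tsupport fun h => hyU (hsub h)
    simp [h0]

end GraphBoundary

/-! ### The divergence theorem on a domain with Lipschitz boundary -/

section DivergenceTheorem

open scoped Manifold ContDiff

variable {d : ℕ} {X : Set (EuclideanSpace ℝ (Fin d))}
  {F : EuclideanSpace ℝ (Fin d) → EuclideanSpace ℝ (Fin d)}

/-- The divergence theorem holds for test functions supported near a given point: outside the closure
of `X` and inside `X` there is no flux, and at a boundary point `X` is the region above a graph. -/
theorem exists_nhds_integral_mul_divergence_add_fderiv (hX : IsOpen X)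
    (hbd : HasLipschitzBoundary X) (hF : ContinuousOn F (closure X)) (hFd : DifferentiableOn ℝ F X)
    (hdiv : IntegrableOn (divergence F) X) (p : EuclideanSpace ℝ (Fin d)) :
    ∃ W, IsOpen W ∧ p ∈ W ∧ ∀ φ : EuclideanSpace ℝ (Fin d) → ℝ, ContDiff ℝ 1 φ →
      HasCompactSupport φ → tsupport φ ⊆ W →
      ∫ x in X, (φ x * divergence F x + fderiv ℝ φ x (F x)) =
        ∫ x, φ x * ⟪F x, outwardNormal X x⟫ ∂surfaceMeasure X := by
  have hzero : ∀ φ : EuclideanSpace ℝ (Fin d) → ℝ, (∀ x ∈ frontier X, φ x = 0) →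
      ∫ x, φ x * ⟪F x, outwardNormal X x⟫ ∂surfaceMeasure X = 0 := fun φ h => by
    rw [surfaceMeasure, setIntegral_congr_fun (g := fun _ => 0) isClosed_frontier.measurableSet
      fun x hx => by simp [h x hx], integral_zero]
  by_cases hpc : p ∈ closure X
  swap
  · refine ⟨(closure X)ᶜ, isClosed_closure.isOpen_compl, hpc, fun φ _ _ hsub => ?_⟩
    have hout : ∀ x ∈ closure X, x ∉ tsupport φ := fun x hx h => hsub h hx
    rw [hzero φ fun x hx =>
      image_eq_zero_of_notMem_tsupport (hout x (frontier_subset_closure hx)),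
      setIntegral_congr_fun (g := fun _ => 0) hX.measurableSet fun x hx => ?_, integral_zero]
    have hx' := hout x (subset_closure hx)
    simp [image_eq_zero_of_notMem_tsupport hx',
      (notMem_tsupport_iff_eventuallyEq.1 hx').fderiv_eq]
  by_cases hp : p ∈ X
  · refine ⟨X, hX, hp, fun φ hφ hc hsub => ?_⟩
    obtain ⟨C, hC⟩ := hφ.lipschitzWith_of_hasCompactSupport hc one_ne_zero
    rw [integral_mul_divergence_add_fderiv_of_tsupport_subset hX hF hFd hdiv hC hc hsub, hzero]
    intro x hx
    rw [hX.frontier_eq] at hx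
    exact image_eq_zero_of_notMem_tsupport fun h => hx.2 (hsub h)
  · obtain ⟨U, hU, ν, hν, K, γ, hγ, hUX⟩ := hbd p (by rw [hX.frontier_eq]; exact ⟨hpc, hp⟩)
    let g : (ℝ ∙ ν)ᗮ → ℝ := fun y => γ y
    have hg : LipschitzWith K g := LipschitzWith.of_dist_le_mul fun y z => hγ.dist_le_mul y z
    have hUX' : ∀ x ∈ interior U, x ∈ X ↔ 0 < graphHeight ν g x := fun x hx => by
      rw [hUX x (interior_subset hx), graphHeight, sub_pos]
      simp only [g, coe_orthogonalProjectionOnto_orthogonal hν]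
    refine ⟨interior U, isOpen_interior, mem_interior_iff_mem_nhds.2 hU, fun φ hφ hc hsub => ?_⟩
    rw [integral_mul_divergence_add_fderiv_of_graph hν hX hF hFd hdiv hg isOpen_interior hUX' hφ hc
      hsub, integral_surfaceMeasure_of_graph hν hX hg isOpen_interior hUX' hsub]

/-- The divergence theorem for `φ • F`, with `φ` a smooth function of compact support. -/
theorem integral_mul_divergence_add_fderiv_eq_flux (hX : IsOpen X) (hbd : HasLipschitzBoundary X)
    (hF : ContinuousOn F (closure X)) (hFd : DifferentiableOn ℝ F X)
    (hdiv : IntegrableOn (divergence F) X)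
    (hflux : Integrable (fun x => ⟪F x, outwardNormal X x⟫) (surfaceMeasure X))
    {φ : EuclideanSpace ℝ (Fin d) → ℝ} (hφ : ContDiff ℝ ∞ φ) (hc : HasCompactSupport φ) :
    ∫ x in X, (φ x * divergence F x + fderiv ℝ φ x (F x)) =
      ∫ x, φ x * ⟪F x, outwardNormal X x⟫ ∂surfaceMeasure X := by
  choose W hWo hpW hW using
    exists_nhds_integral_mul_divergence_add_fderiv hX hbd hF hFd hdiv
  obtain ⟨t, ht⟩ := hc.isCompact.elim_finite_subcover W hWo fun x _ => mem_iUnion.2 ⟨x, hpW x⟩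
  obtain ⟨ρ, hρ⟩ := SmoothPartitionOfUnity.exists_isSubordinate
    𝓘(ℝ, EuclideanSpace ℝ (Fin d)) (isClosed_tsupport φ) (fun i : t => W i) (fun i => hWo i)
    (fun x hx => by simpa using ht hx)
  let φi : t → EuclideanSpace ℝ (Fin d) → ℝ := fun i x => ρ i x * φ x
  have hsum : φ = fun x => ∑ i, φi i x := by
    ext x
    by_cases hx : x ∈ tsupport φ
    · have h1 := ρ.sum_eq_one hx
      rw [finsum_eq_sum_of_fintype] at h1
      rw [← Finset.sum_mul, h1, one_mul]
    · simp [φi, image_eq_zero_of_notMem_tsupport hx]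
  have hφi : ∀ i, ContDiff ℝ 1 (φi i) := fun i =>
    ((ρ i).contMDiff.contDiff.mul hφ).of_le (by exact_mod_cast le_top)
  have hφic : ∀ i, HasCompactSupport (φi i) := fun i => hc.mul_left
  have hφisub : ∀ i, tsupport (φi i) ⊆ W i := fun i =>
    (tsupport_mul_subset_left).trans (hρ i)
  have hint : ∀ i, IntegrableOn
      (fun x => φi i x * divergence F x + fderiv ℝ (φi i) x (F x)) X := fun i => by
    obtain ⟨C, hC⟩ := (hφi i).lipschitzWith_of_hasCompactSupport (hφic i) one_ne_zero
    exact (integrableOn_mul_divergence hdiv hC.continuous (hφic i)).add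
      (integrableOn_fderiv_apply hX hF hC (hφic i))
  have hint' : ∀ i, Integrable
      (fun x => φi i x * ⟪F x, outwardNormal X x⟫) (surfaceMeasure X) := fun i => by
    obtain ⟨M, hM⟩ := (hφic i).exists_bound_of_continuous (hφi i).continuous
    exact hflux.bdd_mul (hφi i).continuous.aestronglyMeasurable (ae_of_all _ hM)
  have hfd : ∀ x, fderiv ℝ φ x (F x) = ∑ i, fderiv ℝ (φi i) x (F x) := fun x => by
    conv_lhs => rw [hsum]
    rw [fderiv_fun_sum fun i _ => (hφi i).differentiable one_ne_zero x]
    simp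
  have hleft : ∀ x, φ x * divergence F x + fderiv ℝ φ x (F x) =
      ∑ i, (φi i x * divergence F x + fderiv ℝ (φi i) x (F x)) := fun x => by
    rw [hfd, Finset.sum_add_distrib, ← Finset.sum_mul, ← congrFun hsum x]
  have hright : ∀ x, φ x * ⟪F x, outwardNormal X x⟫ =
      ∑ i, φi i x * ⟪F x, outwardNormal X x⟫ := fun x => by
    rw [← Finset.sum_mul, ← congrFun hsum x]
  simp only [hleft, hright]
  rw [integral_finsetSum _ fun i _ => hint i, integral_finsetSum _ fun i _ => hint' i]
  exact Finset.sum_congr rfl fun i _ => hW i (φi i) (hφi i) (hφic i) (hφisub i)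

/-- The divergence theorem on an open set with Lipschitz boundary, bounded or not, for an integrable
field that is differentiable inside, continuous up to the boundary, and has integrable divergence
and boundary flux. -/
theorem integral_divergence_eq_boundaryFlux (hX : IsOpen X) (hbd : HasLipschitzBoundary X)
    (hF : ContinuousOn F (closure X)) (hFd : DifferentiableOn ℝ F X) (hFi : IntegrableOn F X)
    (hdiv : IntegrableOn (divergence F) X)
    (hflux : Integrable (fun x => ⟪F x, outwardNormal X x⟫) (surfaceMeasure X)) :
    ∫ x in X, divergence F x = boundaryFlux X F := by
  let χ : ContDiffBump (0 : EuclideanSpace ℝ (Fin d)) := ⟨1, 2, one_pos, one_lt_two⟩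
  let r : ℕ → ℝ := fun k => 1 / ((k : ℝ) + 1)
  have hr0 : ∀ k, 0 < r k := fun k => by positivity
  have hr : Tendsto r atTop (𝓝 0) := tendsto_one_div_add_atTop_nhds_zero_nat
  have hr1 : ∀ k, r k ≤ 1 := fun k => by
    simp only [r]
    rw [div_le_one (by positivity)]
    linarith [(Nat.cast_nonneg k : (0 : ℝ) ≤ k)]
  have hχs : ContDiff ℝ ∞ χ := χ.contDiff
  obtain ⟨C, hC⟩ := hχs.lipschitzWith_of_hasCompactSupport χ.hasCompactSupport (by simp)
  let φ : ℕ → EuclideanSpace ℝ (Fin d) → ℝ := fun k x => χ (r k • x)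
  have hφ : ∀ k, ContDiff ℝ ∞ (φ k) := fun k => hχs.comp (contDiff_const_smul _)
  have hφc : ∀ k, HasCompactSupport (φ k) := fun k =>
    χ.hasCompactSupport.comp_smul (hr0 k).ne'
  have hφ1 : ∀ k x, ‖φ k x‖ ≤ 1 := fun k x => by
    rw [Real.norm_of_nonneg χ.nonneg]
    exact χ.le_one
  have hφlim : ∀ x, Tendsto (fun k => φ k x) atTop (𝓝 1) := fun x => by
    have h1 : Tendsto (fun k => r k • x) atTop (𝓝 0) := by simpa using hr.smul_const x
    have h2 : χ 0 = 1 := χ.one_of_mem_closedBall (by simp [χ])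
    rw [← h2]
    exact (χ.continuous.tendsto 0).comp h1
  have hφd : ∀ k x, ‖fderiv ℝ (φ k) x (F x)‖ ≤ r k * (C * ‖F x‖) := fun k x => by
    have hL : LipschitzWith (C * ‖r k‖₊) (φ k) := hC.comp (lipschitzWith_smul (r k))
    refine ((fderiv ℝ (φ k) x).le_opNorm _).trans ?_
    have h1 := norm_fderiv_le_of_lipschitz ℝ hL (x₀ := x)
    rw [NNReal.coe_mul, coe_nnnorm, Real.norm_of_nonneg (hr0 k).le] at h1
    calc _ ≤ C * r k * ‖F x‖ := by gcongr
      _ = _ := by ring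
  have hleft : Tendsto
      (fun k => ∫ x in X, (φ k x * divergence F x + fderiv ℝ (φ k) x (F x))) atTop
      (𝓝 (∫ x in X, divergence F x)) := by
    refine tendsto_integral_of_dominated_convergence
      (fun x => ‖divergence F x‖ + C * ‖F x‖) (fun k => ?_)
      (hdiv.norm.add (hFi.norm.const_mul _)) (fun k => ae_of_all _ fun x => ?_)
      (ae_of_all _ fun x => ?_)
    · obtain ⟨C', hC'⟩ := (hφ k).lipschitzWith_of_hasCompactSupport (hφc k) (by simp)
      exact ((integrableOn_mul_divergence hdiv hC'.continuous (hφc k)).add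
        (integrableOn_fderiv_apply hX hF hC' (hφc k))).aestronglyMeasurable
    · refine (norm_add_le _ _).trans (add_le_add ?_ ((hφd k x).trans ?_))
      · rw [norm_mul]
        exact mul_le_of_le_one_left (norm_nonneg _) (hφ1 k x)
      · exact mul_le_of_le_one_left (by positivity) (hr1 k)
    · have h1 : Tendsto (fun k => fderiv ℝ (φ k) x (F x)) atTop (𝓝 0) :=
        squeeze_zero_norm (hφd · x) (by simpa using hr.mul_const (C * ‖F x‖))
      simpa using ((hφlim x).mul_const (divergence F x)).add h1
  have hright : Tendsto (fun k => ∫ x, φ k x * ⟪F x, outwardNormal X x⟫ ∂surfaceMeasure X) atTop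
      (𝓝 (∫ x, ⟪F x, outwardNormal X x⟫ ∂surfaceMeasure X)) := by
    refine tendsto_integral_of_dominated_convergence
      (fun x => ‖⟪F x, outwardNormal X x⟫‖) (fun k => ?_) hflux.norm
      (fun k => ae_of_all _ fun x => ?_) (ae_of_all _ fun x => ?_)
    · exact (hφ k).continuous.aestronglyMeasurable.mul hflux.aestronglyMeasurable
    · rw [norm_mul]
      exact mul_le_of_le_one_left (norm_nonneg _) (hφ1 k x)
    · simpa using (hφlim x).mul_const ⟪F x, outwardNormal X x⟫
  refine tendsto_nhds_unique hleft (hright.congr fun k => ?_)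
  exact (integral_mul_divergence_add_fderiv_eq_flux hX hbd hF hFd hdiv hflux (hφ k) (hφc k)).symm

end DivergenceTheorem

/-! ### Weighting by a density -/

/-- The score identity `q ⟪v, ∇ log q⟫ = Dq(v)`. It holds also at the zeros of `q`, which are minima
of `q` and hence critical points. -/
theorem mul_inner_gradient_log {E : Type*} [NormedAddCommGroup E] [InnerProductSpace ℝ E]
    [CompleteSpace E] {q : E → ℝ} {x : E} (hq : DifferentiableAt ℝ q x)
    (hmin : ∀ᶠ y in 𝓝 x, 0 ≤ q y) (v : E) :
    q x * ⟪v, ∇ (fun y => Real.log (q y)) x⟫ = fderiv ℝ q x v := by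
  by_cases h0 : q x = 0
  · have hloc : IsLocalMin q x := by
      filter_upwards [hmin] with y hy
      rwa [h0]
    rw [hloc.fderiv_eq_zero, h0]
    simp
  · rw [real_inner_comm, gradient, InnerProductSpace.toDual_symm_apply, fderiv.log hq h0]
    simp [h0]

theorem proposition1 {d : ℕ} (X : Set (EuclideanSpace ℝ (Fin d)))
    (hX : IsOpen X) (hbd : HasLipschitzBoundary X)
    (q : EuclideanSpace ℝ (Fin d) → ℝ)
    (f : EuclideanSpace ℝ (Fin d) → EuclideanSpace ℝ (Fin d))
    -- `q` is a differentiable probability density on `X`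
    (hq_nonneg : ∀ x ∈ X, 0 ≤ q x)
    (hq_prob : IsProbabilityMeasure (densityMeasure X q))
    (hq_diff : DifferentiableOn ℝ q X)
    -- `f` is differentiable and lies in `L²(q)`
    (hf_diff : DifferentiableOn ℝ f X)
    (hf_L2 : MemLp f 2 (densityMeasure X q))
    -- `f q` has continuous boundary values, so that its flux makes sense
    (hfq_cont : ContinuousOn (fun x => q x • f x) (closure X))
    (hflux : VanishingBoundaryFlux X (fun x => q x • f x))
    -- both expectations exist
    (hdiv_int : Integrable (fun x => divergence f x) (densityMeasure X q))
    (hscore_int : Integrable (fun x => ⟪f x, ∇ (fun y => Real.log (q y)) x⟫)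
      (densityMeasure X q)) :
    ∫ x, divergence f x ∂(densityMeasure X q) =
      -∫ x, ⟪f x, ∇ (fun y => Real.log (q y)) x⟫ ∂(densityMeasure X q) := by
  set s : EuclideanSpace ℝ (Fin d) → ℝ := fun x => ⟪f x, ∇ (fun y => Real.log (q y)) x⟫ with hs
  have hqm : AEMeasurable (fun x => ENNReal.ofReal (q x)) (volume.restrict X) :=
    (hq_diff.continuousOn.aemeasurable hX.measurableSet).ennreal_ofReal
  have htop : ∀ᵐ x ∂volume.restrict X, ENNReal.ofReal (q x) < ∞ :=
    ae_of_all _ fun _ => ENNReal.ofReal_lt_top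
  have htoReal : ∀ x ∈ X, (ENNReal.ofReal (q x)).toReal = q x := fun x hx =>
    ENNReal.toReal_ofReal (hq_nonneg x hx)
  -- integrals against `q` are integrals over `X`, weighted by `q`
  have hint : ∀ {G : Type} [NormedAddCommGroup G] [NormedSpace ℝ G]
      {u : EuclideanSpace ℝ (Fin d) → G}, Integrable u (densityMeasure X q) →
      IntegrableOn (fun x => q x • u x) X := fun h =>
    IntegrableOn.congr_fun ((integrable_withDensity_iff_integrable_smul₀' hqm htop).1 h)
      (fun x hx => by rw [htoReal x hx]) hX.measurableSet
  have hintegral : ∀ u : EuclideanSpace ℝ (Fin d) → ℝ,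
      ∫ x, u x ∂densityMeasure X q = ∫ x in X, q x * u x := fun u => by
    rw [densityMeasure, integral_withDensity_eq_integral_toReal_smul₀ hqm htop]
    exact setIntegral_congr_fun hX.measurableSet fun x hx => by
      simp only [htoReal x hx, smul_eq_mul]
  have hdiv : ∀ x ∈ X, divergence (fun y => q y • f y) x = q x * divergence f x + q x * s x := by
    intro x hx
    have hqx := (hq_diff x hx).differentiableAt (hX.mem_nhds hx)
    rw [divergence_smul hqx ((hf_diff x hx).differentiableAt (hX.mem_nhds hx)), hs,
      mul_inner_gradient_log hqx]
    filter_upwards [hX.mem_nhds hx] with y hy using hq_nonneg y hy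
  have hdivi : IntegrableOn (divergence fun y => q y • f y) X :=
    IntegrableOn.congr_fun ((hint hdiv_int).add (hint hscore_int))
      (fun x hx => (hdiv x hx).symm) hX.measurableSet
  have hfi : IntegrableOn (fun x => q x • f x) X := hint (hf_L2.integrable (by norm_num))
  -- the whole space has no boundary: there, integrability of `q • f` already excludes flux at
  -- infinity
  have hboundary : Integrable (fun x => ⟪q x • f x, outwardNormal X x⟫) (surfaceMeasure X) ∧
      boundaryFlux X (fun x => q x • f x) = 0 := by
    by_cases hu : X = univ
    · simp [hu, boundaryFlux, surfaceMeasure]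
    · exact hflux.1 hu
  have hmain := integral_divergence_eq_boundaryFlux hX hbd hfq_cont (hq_diff.smul hf_diff) hfi hdivi
    hboundary.1
  have hadd : ∫ x in X, (q x * divergence f x + q x * s x) =
      (∫ x in X, q x * divergence f x) + ∫ x in X, q x * s x :=
    integral_add (hint hdiv_int) (hint hscore_int)
  rw [hboundary.2, setIntegral_congr_fun hX.measurableSet hdiv, hadd] at hmain
  rw [hintegral, hintegral]
  exact eq_neg_of_add_eq_zero_left hmain
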